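/- All systems are discrete-time, finite-dimensional, real LTI systems, given by (matrices of) real rational transfer functions $\widehat G(z)$ and acting on signals $(u^t)_{t\ge 0}$ by convolution with the impulse response (system at rest before time $0$). A system is causal if $\widehat G$ is proper (every entry proper), and strictly causal if every entry is strictly proper. In the feedback loops with gradients below, an arbitrary finitely supported exogenous signal $d$ is added to the gradient signal; it plays the role of the initial condition. **Optimization method.** A SISO system $G_{\mathrm{opt}}$ is an *optimization method* if there is $\epsilon_0>0$ such that for all $0<\epsilon<\epsilon_0$, $y^\star\in\mathbb R$ and all $d$, the loop $y=G_{\mathrm{opt}}u$, $u^t=\nabla f(y^t)+d^t$ with $f(y)=\frac{\epsilon}{2}(y-y^\star)^2$ has a solution and every solution satisfies $y^t\to y^\star$; and if for $\epsilon=0$, $y^t$ converges to a constant. **Networks.** A network on $n$ agents is a directed graph; it is connected if there is a directed path between any two agents. An associated Laplacian is $L=\mathrm{diag}(A\mathbf 1)-A$, where $A=[a_{ij}]$ has nonnegative real entries and $a_{ij}\neq0$ exactly for the edges of the network; it is balanced if $\mathbf 1^{\mathsf T}L=0$. A property holds "for Laplacians with small spectral radius" if for every $n$ and every connected network on $n$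 agents there is $\delta>0$ such that it holds for every associated balanced Laplacian $L$ of spectral radius less than $\delta$. **Consensus estimator.** Let $G=\begin{bmatrix}G^{11}&G^{12}\\G^{21}&G^{22}\end{bmatrix}$ have inputs $(w,v)$ and outputs $(y,z)$, with $w,y$ scalar and $v,z$ of dimension $m$. Each agent $i$ runs a copy of $G$, and $v_i=\sum_j a_{ij}(z_i-z_j)$. $G$ is a *consensus estimator of order $\ell$* if, for Laplacians with small spectral radius that are diagonalizable over $\mathbb C$, and for all signals $w_i^t$ that are polynomials in $t$ of degree at most $\ell-1$ with constant mean $w^\star=\frac1n\sum_j w_j^t$, the interconnection has a solution and in every solution $y_i^t\to w^\star$ for all $i$. **Distributed optimization algorithm.** Let $H$ be partitioned likewise, with inputs $(u,v)$ and outputs $(y,z)$. $H$ is a *distributed optimization algorithm* if, for Laplacians with small spectral radius, the interconnection of $n$ copies of $H$ with $v_i=\sum_j a_{ij}(z_i-z_j)$ and $u_i^t=\nabla f_i(y_i^t)+d_i^t$ satisfies: (a) there is $\epsilon_0>0$ (which may depend on $L$) such that for all $0<\epsilon<\epsilon_0$, all $y_1^\star,\dots,y_n^\star\in\mathbb R$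 and all $d_i$, with $f_i(y)=\frac{\epsilon}{2}(y-y_i^\star)^2$, there is a solution, and in every solution $y_i^t\to\frac1n\sum_j y_j^\star$ for all $i$; (b) with $f_i\equiv0$ and all $d_i$, there is a solution, and in every solution all $y_i^t$ converge to a common constant. For $\lambda\in\mathbb C$ put $G_\lambda=G_{\mathrm{con}}^{11}+\lambda\,G_{\mathrm{con}}^{12}(I-\lambda G_{\mathrm{con}}^{22})^{-1}G_{\mathrm{con}}^{21}$. **Theorem.** Let $G_{\mathrm{opt}}$ be a causal SISO LTI optimization method and let $G_{\mathrm{con}}$ be a causal LTI consensus estimator of order two with $G_{\mathrm{con}}^{22}$ strictly causal. Assume - $\widehat G_{\mathrm{opt}}(z)$ is minimum-phase, i.e. all its zeros lie in the open unit disk; and, for Laplacians $L$ with small spectral radius and every eigenvalue $\lambda$ of $L$, all zeros of $\widehat G_\lambda(z)$ other than $z=1$ lie in the open unit disk (for $\lambda\ne0$ a second-order estimator always has zeros at $z=1$); - $\widehat G_{\mathrm{opt}}(z)$ is strictly proper, or $\widehat G_{\mathrm{con}}^{21}(z)\,\widehat G_{\mathrm{con}}^{12}(z)$ is strictly proper.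 Then the combined system $$H=G_{\mathrm{con}}\begin{bmatrix}G_{\mathrm{opt}}&0\\0&I_m\end{bmatrix}$$ is causal, $H^{22}$ and $H^{21}H^{12}$ are strictly causal, and $H$ is a distributed optimization algorithm. -/

import Mathlib

open Filter Topology

noncomputable section

namespace DistOpt

/-! ### Transfer functions (real rational functions of `z`) -/

/-- Causality of the LTI system with transfer function `G`. -/
def IsProper (G : RatFunc ℝ) : Prop := G.num.degree ≤ G.denom.degree

/-- Strict causality of the LTI system with transfer function `G`. -/
def IsStrictlyProper (G : RatFunc ℝ) : Prop := G.num.degree < G.denom.degree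

/-- The impulse response `h` of a proper `G = p / q`: the expansion `G(z) = ∑ₖ hₖ z⁻ᵏ` at infinity,
as a power series in `X = z⁻¹`. Here `p.reverse` is `p(1/X) * X ^ natDegree p`. -/
def impulseResponse (G : RatFunc ℝ) : PowerSeries ℝ :=
  PowerSeries.X ^ (G.denom.natDegree - G.num.natDegree) *
    (G.num.reverse : PowerSeries ℝ) * (G.denom.reverse : PowerSeries ℝ)⁻¹

/-- The output `yᵗ = ∑_{k ≤ t} hₖ uᵗ⁻ᵏ` of the SISO system `G`, at rest before time `0`, for the
input `u`. -/
def response (G : RatFunc ℝ) (u : ℕ → ℝ) (t : ℕ) : ℝ :=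
  ∑ k ∈ Finset.range (t + 1), PowerSeries.coeff k (impulseResponse G) * u (t - k)

/-- The output of the MIMO system with transfer matrix `G`. -/
def matrixResponse {ι κ : Type*} [Fintype κ] (G : Matrix ι κ (RatFunc ℝ)) (u : κ → ℕ → ℝ) :
    ι → ℕ → ℝ :=
  fun i t => ∑ j, response (G i j) (u j) t

/-- A system with inputs `(u, v)` and outputs `(y, z)`, where `u, y` are scalar signals and `v, z`
have `m` components. -/
abbrev AgentSystem (m : ℕ) : Type := Matrix (Unit ⊕ Fin m) (Unit ⊕ Fin m) (RatFunc ℝ)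

/-- A real rational function regarded as a complex one. -/
def toComplex : RatFunc ℝ →+* RatFunc ℂ :=
  RatFunc.mapRingHom (Polynomial.mapRingHom Complex.ofRealHom)
    (nonZeroDivisors_le_comap_nonZeroDivisors_of_injective _
      (Polynomial.map_injective _ Complex.ofRealHom.injective))

/-- `G_λ = G¹¹ + λ G¹² (I - λ G²²)⁻¹ G²¹`. -/
def closeWith {m : ℕ} (G : AgentSystem m) (lam : ℂ) : RatFunc ℂ :=
  let M : Matrix (Unit ⊕ Fin m) (Unit ⊕ Fin m) (RatFunc ℂ) := G.map toComplex
  (M.toBlocks₁₁ + lam • (M.toBlocks₁₂ * (1 - lam • M.toBlocks₂₂)⁻¹ * M.toBlocks₂₁)) () ()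

/-- `z` is a (finite) zero of `G`. -/
def IsZeroOf (z : ℂ) (G : RatFunc ℂ) : Prop := G.num.IsRoot z

/-! ### Optimization methods -/

/-- The quadratic test function `f(y) = (ε / 2) (y - y⋆)²`. -/
def quadratic (ε ystar : ℝ) (x : ℝ) : ℝ := ε / 2 * (x - ystar) ^ 2

/-- `(u, y)` is a trajectory of `G` in feedback with `∇f`. The finitely supported exogenous input
`d` produces the initial state: once `d` has vanished, the loop runs autonomously from
an arbitrary reachable state. -/
structure IsOptTrajectory (G : RatFunc ℝ) (f : ℝ → ℝ) (d : ℕ →₀ ℝ) (u y : ℕ → ℝ) : Prop where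
  system : y = response G u
  feedback : ∀ t, u t = deriv f (y t) + d t

/-- The SISO LTI system `G` is an optimization method. -/
structure IsOptimizationMethod (G : RatFunc ℝ) : Prop where
  /-- For all small `ε > 0` the loop with `f = (ε / 2) (· - y⋆)²` converges to `y⋆`. -/
  optimizes : ∃ ε₀ > 0, ∀ ε, 0 < ε → ε < ε₀ → ∀ (ystar : ℝ) (d : ℕ →₀ ℝ),
    (∃ u y, IsOptTrajectory G (quadratic ε ystar) d u y) ∧
    ∀ u y, IsOptTrajectory G (quadratic ε ystar) d u y → Tendsto y atTop (𝓝 ystar)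
  /-- For `ε = 0` the output converges to a constant. -/
  idle : ∀ (ystar : ℝ) (d : ℕ →₀ ℝ) (u y : ℕ → ℝ),
    IsOptTrajectory G (quadratic 0 ystar) d u y → ∃ c, Tendsto y atTop (𝓝 c)

/-! ### Networks and Laplacians -/

/-- The Laplacian `diag(A 1) - A` of the weight matrix `A`. -/
def laplacian {n : ℕ} (A : Matrix (Fin n) (Fin n) ℝ) : Matrix (Fin n) (Fin n) ℝ :=
  Matrix.diagonal (fun i => ∑ j, A i j) - A

/-- The Laplacian as a complex matrix. -/
def laplacianC {n : ℕ} (A : Matrix (Fin n) (Fin n) ℝ) : Matrix (Fin n) (Fin n) ℂ :=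
  (laplacian A).map Complex.ofReal

/-- There is a directed path between any two agents. -/
def IsConnected {n : ℕ} (N : Digraph (Fin n)) : Prop :=
  ∀ i j, Relation.ReflTransGen N.Adj i j

/-- `A` is a matrix of nonnegative weights on the network `N` with balanced Laplacian. -/
structure IsBalancedWeighting {n : ℕ} (N : Digraph (Fin n)) (A : Matrix (Fin n) (Fin n) ℝ) :
    Prop where
  nonneg : ∀ i j, 0 ≤ A i j
  support : ∀ i j, A i j ≠ 0 ↔ N.Adj i j
  balanced : ∀ j, ∑ i, laplacian A i j = 0

/-- `P` holds for every connected network and every associated balanced Laplacian with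
sufficiently small spectral radius. -/
def ForSmallLaplacians (P : ∀ n : ℕ, Matrix (Fin n) (Fin n) ℝ → Prop) : Prop :=
  ∀ (n : ℕ) (N : Digraph (Fin n)), IsConnected N → ∃ δ > (0 : ℝ),
    ∀ A, IsBalancedWeighting N A → spectralRadius ℂ (laplacianC A) < ENNReal.ofReal δ → P n A

/-- Diagonalizability over the complex numbers. -/
def IsDiagonalizable {n : ℕ} (M : Matrix (Fin n) (Fin n) ℂ) : Prop :=
  ∃ (P : Matrix (Fin n) (Fin n) ℂ) (D : Fin n → ℂ), IsUnit P ∧ M * P = P * Matrix.diagonal D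

/-- Every agent `i` runs its own copy of `G`, with inputs `(wᵢ, vᵢ)` and outputs `(yᵢ, zᵢ)`, and
the agents communicate over the network with weights `A`. -/
structure IsNetworkTrajectory {m n : ℕ} (G : AgentSystem m) (A : Matrix (Fin n) (Fin n) ℝ)
    (w : Fin n → ℕ → ℝ) (v : Fin n → Fin m → ℕ → ℝ)
    (y : Fin n → ℕ → ℝ) (z : Fin n → Fin m → ℕ → ℝ) : Prop where
  system : ∀ i, Sum.elim (fun _ => y i) (z i) =
    matrixResponse G (Sum.elim (fun _ => w i) (v i))
  network : ∀ i k t, v i k t = ∑ j, A i j * (z i k t - z j k t)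

/-! ### Consensus estimators -/

/-- The LTI system `G` is a consensus estimator of order `l`. -/
def IsConsensusEstimator {m : ℕ} (l : ℕ) (G : AgentSystem m) : Prop :=
  ForSmallLaplacians fun n A => IsDiagonalizable (laplacianC A) →
    ∀ (p : Fin n → Polynomial ℝ) (wstar : ℝ), (∀ i, (p i).degree < l) →
      (∀ t : ℕ, (∑ i, (p i).eval (t : ℝ)) / n = wstar) →
      (∃ v y z, IsNetworkTrajectory G A (fun i t => (p i).eval (t : ℝ)) v y z) ∧
      ∀ v y z, IsNetworkTrajectory G A (fun i t => (p i).eval (t : ℝ)) v y z →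
        ∀ i, Tendsto (y i) atTop (𝓝 wstar)

/-! ### Distributed optimization algorithms -/

/-- A trajectory of `n` copies of `H` in feedback with the network and with the local gradients
`∇fᵢ`; `dᵢ` is a finitely supported exogenous input that produces the initial state. -/
structure IsDistTrajectory {m n : ℕ} (H : AgentSystem m) (A : Matrix (Fin n) (Fin n) ℝ)
    (f : Fin n → ℝ → ℝ) (d : Fin n → ℕ →₀ ℝ)
    (u : Fin n → ℕ → ℝ) (v : Fin n → Fin m → ℕ → ℝ)
    (y : Fin n → ℕ → ℝ) (z : Fin n → Fin m → ℕ → ℝ) : Prop where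
  network : IsNetworkTrajectory H A u v y z
  feedback : ∀ i t, u i t = deriv (f i) (y i t) + d i t

/-- The LTI system `H` is a distributed optimization algorithm. -/
def IsDistributedOptimizationAlgorithm {m : ℕ} (H : AgentSystem m) : Prop :=
  ForSmallLaplacians fun n A =>
    (∃ ε₀ > 0, ∀ ε, 0 < ε → ε < ε₀ → ∀ (ystar : Fin n → ℝ) (d : Fin n → ℕ →₀ ℝ),
      (∃ u v y z, IsDistTrajectory H A (fun i => quadratic ε (ystar i)) d u v y z) ∧
      ∀ u v y z, IsDistTrajectory H A (fun i => quadratic ε (ystar i)) d u v y z →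
        ∀ i, Tendsto (y i) atTop (𝓝 ((∑ j, ystar j) / n))) ∧
    (∀ d : Fin n → ℕ →₀ ℝ,
      (∃ u v y z, IsDistTrajectory H A (fun _ _ => 0) d u v y z) ∧
      ∀ u v y z, IsDistTrajectory H A (fun _ _ => 0) d u v y z →
        ∃ c, ∀ i, Tendsto (y i) atTop (𝓝 c))

/-- The combined system `G_con · diag(G_opt, I)`. -/
def combine {m : ℕ} (Gcon : AgentSystem m) (Gopt : RatFunc ℝ) : AgentSystem m :=
  Gcon * Matrix.fromBlocks (Matrix.of fun _ _ => Gopt) 0 0 1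

end DistOpt

end

noncomputable section

namespace DistOpt

/-! ### Stable polynomials in `X = z⁻¹` -/

/-! Signals and systems become power series in X = z⁻¹. A rational series in lowest terms has
coefficients tending to zero exactly when its denominator has no root in the closed unit disk
(`isStable_of_vanishing`, `vanishing_of_isStable`), so convergence turns into algebra of
polynomials.

Eliminating the messages from a network with Laplacian L gives D(L) Y = N(L) W, where D and N are
coprime elements of ℂ[X][X] (inner variable X, outer variable λ) that serve all networks at once
(`exists_transfer`). The consensus hypothesis concerns diagonalizable Laplacians only and the
conclusion concerns all balanced ones; the bridge is to study D and N one λ at a time. By Birkhoff's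
theorem the spectrum of a balanced Laplacian lies in a sector that depends only on the number of
agents (`IsBalancedWeighting.abs_im_le`). Conversely, every λ with positive real part in a given
sector is an eigenvalue of a diagonalizable circulant Laplacian on a complete network of fixed size,
with spectral radius at most a constant times Re λ (`exists_diagonalizable_laplacian`). Ramps fed to
that network and read through a left eigenvector show that D(λ) is stable and (X - 1)² divides N(λ),
for all small λ of the sector. Hence (X - 1)² divides N itself (`exists_transfer_of_consensus`).

The closed loop then splits in two. On the average, L acts as 0 and the loop consists of G¹¹ G_opt
and the gain ε. Here G¹¹ is stable with static gain 1, and G_opt = p / ((1 - X) q) with q stable and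
p(1) q(1) < 0, so a small ε pushes the root at 1 out of the disk (`exists_isStable_sub`). On the
disagreement, one factor X - 1 of N cancels the pole of G_opt and the other cancels the pole of the
constants y⋆. With N = (X - 1)² N', what remains is the matrix q D(L) - ε p (1 - X) N'(L) with
polynomial forcing; its determinant is stable at ε = 0 by spectral mapping, and for small ε by
compactness of the disk (`exists_vanishing_disagreement`). Nothing is known about D(0), so on the
disagreement the eigenvalue 0 of L is first moved to a small positive κ
(`IsBalancedWeighting.intertwine`). -/

/-- All roots of `Q` lie outside the closed unit disk. -/
def IsStable (Q : Polynomial ℂ) : Prop := ∀ x : ℂ, ‖x‖ ≤ 1 → Q.eval x ≠ 0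

/-- The coefficients of `F` tend to zero. -/
def Vanishing (F : PowerSeries ℂ) : Prop := Tendsto (fun t => PowerSeries.coeff t F) atTop (𝓝 0)

theorem IsStable.ne_zero {Q : Polynomial ℂ} (h : IsStable Q) : Q ≠ 0 := by
  rintro rfl
  exact h 0 (by simp) (by simp)

theorem IsStable.mul {P Q : Polynomial ℂ} (hP : IsStable P) (hQ : IsStable Q) :
    IsStable (P * Q) := fun x hx => by
  rw [Polynomial.eval_mul]
  exact mul_ne_zero (hP x hx) (hQ x hx)

theorem Vanishing.add {F G : PowerSeries ℂ} (hF : Vanishing F) (hG : Vanishing G) :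
    Vanishing (F + G) := by
  simpa [Vanishing] using Tendsto.add hF hG

theorem Vanishing.X_mul {F : PowerSeries ℂ} (hF : Vanishing F) :
    Vanishing (PowerSeries.X * F) := by
  unfold Vanishing
  rw [← tendsto_add_atTop_iff_nat 1]
  simp only [PowerSeries.coeff_succ_X_mul]
  exact hF

theorem Vanishing.C_mul {F : PowerSeries ℂ} (hF : Vanishing F) (c : ℂ) :
    Vanishing (PowerSeries.C c * F) := by
  simpa [Vanishing] using Tendsto.const_mul c hF

theorem Vanishing.coe_mul {F : PowerSeries ℂ} (hF : Vanishing F) (P : Polynomial ℂ) :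
    Vanishing ((P : PowerSeries ℂ) * F) := by
  induction P using Polynomial.induction_on' with
  | add p q hp hq => rw [Polynomial.coe_add, add_mul]; exact hp.add hq
  | monomial n a =>
    rw [← Polynomial.C_mul_X_pow_eq_monomial]
    induction n with
    | zero => simpa using hF.C_mul a
    | succ n ih =>
      rw [pow_succ', ← mul_assoc, mul_comm (Polynomial.C a), mul_assoc, Polynomial.coe_mul,
        mul_assoc, Polynomial.coe_X]
      exact ih.X_mul

theorem Vanishing.sum {ι : Type*} {s : Finset ι} {F : ι → PowerSeries ℂ}
    (h : ∀ i ∈ s, Vanishing (F i)) : Vanishing (∑ i ∈ s, F i) := by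
  classical
  induction s using Finset.induction_on with
  | empty => simp [Vanishing]
  | insert a s ha ih =>
    rw [Finset.sum_insert ha]
    exact (h a (by simp)).add (ih fun i hi => h i (by simp [hi]))

/-- A vanishing rational power series has no poles in the closed unit disk. -/
theorem isStable_of_vanishing {P Q : Polynomial ℂ} {F : PowerSeries ℂ} (hPQ : IsCoprime P Q)
    (h : (Q : PowerSeries ℂ) * F = P) (hF : Vanishing F) : IsStable Q := by
  intro x hx hQ
  obtain ⟨Q₁, rfl⟩ := Polynomial.dvd_iff_isRoot.2 hQ
  have hP : P.eval x ≠ 0 := by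
    intro hP
    obtain ⟨a, b, hab⟩ := hPQ
    have := congrArg (Polynomial.eval x) hab
    simp [hP] at this
  set F₁ : PowerSeries ℂ := (Q₁ : PowerSeries ℂ) * F with hF₁
  have hF₁' : Vanishing F₁ := hF.coe_mul Q₁
  have h₁ : (PowerSeries.X - PowerSeries.C x) * F₁ = (P : PowerSeries ℂ) := by
    rw [hF₁, ← mul_assoc, ← h]
    simp
  -- Beyond the degree of P the coefficients of F₁ = P / (X - x) satisfy f_t = x f_{t+1}. As ‖x‖ ≤ 1
  -- their norms cannot decrease, so tending to zero forces them to vanish: F₁ is a polynomial and x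
  -- is a root of P, against coprimality.
  have hrec : ∀ t, P.natDegree ≤ t → PowerSeries.coeff t F₁ = x * PowerSeries.coeff (t + 1) F₁ := by
    intro t ht
    have := congrArg (PowerSeries.coeff (t + 1)) h₁
    rw [sub_mul, map_sub, PowerSeries.coeff_succ_X_mul, PowerSeries.coeff_C_mul,
      Polynomial.coeff_coe, Polynomial.coeff_eq_zero_of_natDegree_lt (by omega)] at this
    linear_combination this
  have hmono : ∀ t, P.natDegree ≤ t → ∀ k,
      ‖PowerSeries.coeff t F₁‖ ≤ ‖PowerSeries.coeff (t + k) F₁‖ := by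
    intro t ht k
    induction k with
    | zero => simp
    | succ k ih =>
      refine ih.trans ?_
      rw [hrec (t + k) (by omega), norm_mul]
      exact mul_le_of_le_one_left (norm_nonneg _) hx
  have hzero : ∀ t, P.natDegree ≤ t → PowerSeries.coeff t F₁ = 0 := by
    intro t ht
    have hlim : Tendsto (fun k => ‖PowerSeries.coeff (t + k) F₁‖) atTop (𝓝 0) := by
      have := (tendsto_add_atTop_iff_nat t).2 hF₁'.norm
      simpa [add_comm] using this
    exact norm_le_zero_iff.1 (ge_of_tendsto' hlim (hmono t ht))
  have hpoly : F₁ = (PowerSeries.trunc P.natDegree F₁ : Polynomial ℂ) := by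
    ext t
    rw [Polynomial.coeff_coe, PowerSeries.coeff_trunc]
    split_ifs with ht
    · rfl
    · exact hzero t (by omega)
  rw [hpoly] at h₁
  have h₂ : (Polynomial.X - Polynomial.C x) * PowerSeries.trunc P.natDegree F₁ = P := by
    apply Polynomial.coe_injective ℂ
    rw [← h₁]; simp
  apply hP
  rw [← h₂]
  simp

/-- A power series with norm-summable coefficients. -/
def IsSummable (F : PowerSeries ℂ) : Prop := Summable fun t => ‖PowerSeries.coeff t F‖

theorem IsSummable.vanishing {F : PowerSeries ℂ} (h : IsSummable F) : Vanishing F :=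
  tendsto_zero_iff_norm_tendsto_zero.2 h.tendsto_atTop_zero

theorem IsSummable.mul {F G : PowerSeries ℂ} (hF : IsSummable F) (hG : IsSummable G) :
    IsSummable (F * G) := by
  have := summable_norm_sum_mul_antidiagonal_of_summable_norm hF hG
  simpa [IsSummable, PowerSeries.coeff_mul] using this

theorem isSummable_coe (P : Polynomial ℂ) : IsSummable (P : PowerSeries ℂ) := by
  refine summable_of_ne_finset_zero (s := P.support) fun t ht => ?_
  simpa using ht

theorem isSummable_geometric {a : ℂ} (ha : ‖a‖ < 1) :
    IsSummable (PowerSeries.mk fun t => a ^ t) := by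
  simpa [IsSummable] using summable_geometric_of_lt_one (norm_nonneg a) ha

/-- A rational power series without poles in the closed unit disk is summable. -/
theorem isSummable_of_isStable {Q : Polynomial ℂ} (hQ : IsStable Q) {P : Polynomial ℂ}
    {F : PowerSeries ℂ} (h : (Q : PowerSeries ℂ) * F = P) : IsSummable F := by
  -- The roots of Q are divided out one at a time; each division by X - x with ‖x‖ > 1 is a product
  -- with a geometric series in x⁻¹, which preserves summability.
  suffices H : ∀ (s : Multiset ℂ) (F : PowerSeries ℂ), (∀ x ∈ s, 1 < ‖x‖) →
      IsSummable (((s.map fun x => Polynomial.X - Polynomial.C x).prod : Polynomial ℂ) * F) →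
      IsSummable F by
    have hs := (IsAlgClosed.splits Q).eq_prod_roots
    have hc : Q.leadingCoeff ≠ 0 := Polynomial.leadingCoeff_ne_zero.2 hQ.ne_zero
    refine H Q.roots F (fun x hx => ?_) ?_
    · by_contra hlt
      exact hQ x (not_lt.1 hlt) (Polynomial.isRoot_of_mem_roots hx)
    · have : (((Q.roots.map fun x => Polynomial.X - Polynomial.C x).prod : Polynomial ℂ) :
          PowerSeries ℂ) * F = ((Polynomial.C Q.leadingCoeff⁻¹ * P : Polynomial ℂ) :
          PowerSeries ℂ) := by
        rw [Polynomial.coe_mul, ← h, ← mul_assoc, ← Polynomial.coe_mul]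
        congr 2
        nth_rewrite 3 [hs]
        rw [← mul_assoc, ← Polynomial.C_mul, inv_mul_cancel₀ hc, Polynomial.C_1, one_mul]
      rw [this]
      exact isSummable_coe _
  intro s
  induction s using Multiset.induction_on with
  | empty => intro F _ h; simpa using h
  | cons x s ih =>
    intro F hs h
    refine ih F (fun y hy => hs y (Multiset.mem_cons_of_mem hy)) ?_
    rw [Multiset.map_cons, Multiset.prod_cons, Polynomial.coe_mul, mul_assoc] at h
    set G := (((s.map fun x => Polynomial.X - Polynomial.C x).prod : Polynomial ℂ) :
      PowerSeries ℂ) * F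
    have hx : 1 < ‖x‖ := hs x (Multiset.mem_cons_self x s)
    have hx0 : x ≠ 0 := fun h0 => by simp [h0] at hx; linarith
    have hgeo : (PowerSeries.mk fun t => (x⁻¹) ^ t) * (1 - PowerSeries.C x⁻¹ * PowerSeries.X) = 1 := by
      ext t
      rw [mul_sub, mul_one, mul_comm (PowerSeries.C x⁻¹), ← mul_assoc, map_sub]
      cases t with
      | zero => simp
      | succ t => simp [PowerSeries.coeff_one, pow_succ, mul_comm]
    have : G = PowerSeries.C (-x⁻¹) *
        (PowerSeries.mk (fun t => (x⁻¹) ^ t) *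
        (((Polynomial.X - Polynomial.C x : Polynomial ℂ) : PowerSeries ℂ) * G)) := by
      have hxx : PowerSeries.C x⁻¹ * PowerSeries.C x = 1 := by
        rw [← map_mul, inv_mul_cancel₀ hx0, map_one]
      simp only [Polynomial.coe_C, Polynomial.coe_sub, Polynomial.coe_X, map_neg]
      linear_combination (-G) * hgeo - (PowerSeries.mk fun t => (x⁻¹) ^ t) * G * hxx
    rw [this, ← Polynomial.coe_C]
    refine (isSummable_coe _).mul ((isSummable_geometric ?_).mul h)
    rw [norm_inv]
    exact inv_lt_one_of_one_lt₀ hx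

theorem vanishing_of_isStable {Q : Polynomial ℂ} (hQ : IsStable Q) {P : Polynomial ℂ}
    {F : PowerSeries ℂ} (h : (Q : PowerSeries ℂ) * F = P) : Vanishing F :=
  (isSummable_of_isStable hQ h).vanishing

/-- The series `1 / (1 - X)` of the constant signal `1`. -/
def stepSeries : PowerSeries ℂ := PowerSeries.mk 1

theorem one_sub_X_mul_stepSeries :
    ((1 - Polynomial.X : Polynomial ℂ) : PowerSeries ℂ) * stepSeries = 1 := by
  rw [mul_comm]
  simpa [stepSeries] using PowerSeries.mk_one_mul_one_sub_eq_one ℂ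

/-- If `(1 - X) F` is summable, then the coefficients of `F` converge. -/
theorem exists_tendsto_of_isSummable {F : PowerSeries ℂ}
    (h : IsSummable (((1 - Polynomial.X : Polynomial ℂ) : PowerSeries ℂ) * F)) :
    ∃ c, Tendsto (fun t => PowerSeries.coeff t F) atTop (𝓝 c) := by
  set G := ((1 - Polynomial.X : Polynomial ℂ) : PowerSeries ℂ) * F with hG
  have hF : F = G * PowerSeries.mk 1 := by
    have := one_sub_X_mul_stepSeries
    rw [stepSeries] at this
    rw [hG]
    linear_combination (-F) * this
  have hs : Summable fun t => PowerSeries.coeff t G := Summable.of_norm h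
  -- Dividing by 1 - X takes partial sums; the shift by one is there because coefficient t sums over
  -- the indices 0, …, t.
  refine ⟨_, ((tendsto_add_atTop_iff_nat 1).2 hs.hasSum.tendsto_sum_nat).congr fun t => ?_⟩
  rw [hF, PowerSeries.coeff_mul, Finset.Nat.sum_antidiagonal_eq_sum_range_succ_mk]
  simp

/-! ### Impulse responses -/

theorem isStrictlyProper_zero : IsStrictlyProper 0 := by
  simp [IsStrictlyProper]

/-- Additivity of the relative degree under products, despite possible cancellation in `G₁ * G₂`; it
is written without subtraction to avoid truncation in ℕ. -/
theorem natDegree_num_mul_add {G₁ G₂ : RatFunc ℝ} (h₁ : G₁ ≠ 0) (h₂ : G₂ ≠ 0) :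
    (G₁ * G₂).num.natDegree + (G₁.denom.natDegree + G₂.denom.natDegree) =
      G₁.num.natDegree + G₂.num.natDegree + (G₁ * G₂).denom.natDegree := by
  have := congrArg Polynomial.natDegree (RatFunc.num_denom_mul G₁ G₂)
  rwa [Polynomial.natDegree_mul (RatFunc.num_ne_zero (mul_ne_zero h₁ h₂))
      (mul_ne_zero (RatFunc.denom_ne_zero _) (RatFunc.denom_ne_zero _)),
    Polynomial.natDegree_mul (RatFunc.denom_ne_zero _) (RatFunc.denom_ne_zero _),
    Polynomial.natDegree_mul (mul_ne_zero (RatFunc.num_ne_zero h₁) (RatFunc.num_ne_zero h₂))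
      (RatFunc.denom_ne_zero _),
    Polynomial.natDegree_mul (RatFunc.num_ne_zero h₁) (RatFunc.num_ne_zero h₂)] at this

theorem isProper_iff {G : RatFunc ℝ} : IsProper G ↔ G.num.natDegree ≤ G.denom.natDegree := by
  rw [IsProper, Polynomial.degree_eq_natDegree (RatFunc.denom_ne_zero G),
    Polynomial.natDegree_le_iff_degree_le]

theorem isStrictlyProper_iff {G : RatFunc ℝ} (hG : G ≠ 0) :
    IsStrictlyProper G ↔ G.num.natDegree < G.denom.natDegree := by
  rw [IsStrictlyProper, Polynomial.degree_eq_natDegree (RatFunc.denom_ne_zero G),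
    Polynomial.degree_eq_natDegree (RatFunc.num_ne_zero hG), Nat.cast_lt]

theorem IsProper.mul {G₁ G₂ : RatFunc ℝ} (h₁ : IsProper G₁) (h₂ : IsProper G₂) :
    IsProper (G₁ * G₂) := by
  rcases eq_or_ne G₁ 0 with rfl | hG₁
  · simpa using h₁
  rcases eq_or_ne G₂ 0 with rfl | hG₂
  · simpa using h₂
  have := natDegree_num_mul_add hG₁ hG₂
  rw [isProper_iff] at *
  omega

theorem IsStrictlyProper.mul_isProper {G₁ G₂ : RatFunc ℝ} (h₁ : IsStrictlyProper G₁)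
    (h₂ : IsProper G₂) : IsStrictlyProper (G₁ * G₂) := by
  rcases eq_or_ne G₁ 0 with rfl | hG₁
  · simpa using h₁
  rcases eq_or_ne G₂ 0 with rfl | hG₂
  · simpa using isStrictlyProper_zero
  have := natDegree_num_mul_add hG₁ hG₂
  rw [isStrictlyProper_iff (mul_ne_zero hG₁ hG₂)]
  rw [isStrictlyProper_iff hG₁] at h₁
  rw [isProper_iff] at h₂
  omega

theorem constantCoeff_reverse_denom_ne_zero (G : RatFunc ℝ) :
    PowerSeries.constantCoeff (G.denom.reverse : PowerSeries ℝ) ≠ 0 := by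
  rw [Polynomial.constantCoeff_coe, Polynomial.coeff_zero_reverse, Ne,
    Polynomial.leadingCoeff_eq_zero]
  exact RatFunc.denom_ne_zero G

theorem reverse_denom_mul_impulseResponse (G : RatFunc ℝ) :
    (G.denom.reverse : PowerSeries ℝ) * impulseResponse G =
      PowerSeries.X ^ (G.denom.natDegree - G.num.natDegree) * (G.num.reverse : PowerSeries ℝ) := by
  rw [impulseResponse]
  have := PowerSeries.mul_inv_cancel _ (constantCoeff_reverse_denom_ne_zero G)
  linear_combination PowerSeries.X ^ (G.denom.natDegree - G.num.natDegree) *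
    (G.num.reverse : PowerSeries ℝ) * this

theorem exists_mul_impulseResponse_eq (G : RatFunc ℝ) : ∃ P Q : Polynomial ℝ,
    Q.coeff 0 ≠ 0 ∧ (Q : PowerSeries ℝ) * impulseResponse G = P := by
  refine ⟨Polynomial.X ^ (G.denom.natDegree - G.num.natDegree) * G.num.reverse,
    G.denom.reverse, ?_, ?_⟩
  · simpa using constantCoeff_reverse_denom_ne_zero G
  · rw [reverse_denom_mul_impulseResponse]; simp

theorem impulseResponse_zero : impulseResponse 0 = 0 := by
  simp [impulseResponse]

/-- Reversal of polynomials is multiplicative over a domain and relative degrees add. Properness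
matters because the exponent of X in `impulseResponse` is a truncated subtraction. -/
theorem impulseResponse_mul {G₁ G₂ : RatFunc ℝ} (h₁ : IsProper G₁) (h₂ : IsProper G₂) :
    impulseResponse (G₁ * G₂) = impulseResponse G₁ * impulseResponse G₂ := by
  rcases eq_or_ne G₁ 0 with rfl | hG₁
  · simp [impulseResponse_zero]
  rcases eq_or_ne G₂ 0 with rfl | hG₂
  · simp [impulseResponse_zero]
  have hdeg := natDegree_num_mul_add hG₁ hG₂
  rw [isProper_iff] at h₁ h₂
  set G := G₁ * G₂ with hG
  have hrev := congrArg Polynomial.reverse (RatFunc.num_denom_mul G₁ G₂)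
  simp only [Polynomial.reverse_mul_of_domain] at hrev
  replace hrev := congrArg (fun P : Polynomial ℝ => (P : PowerSeries ℝ)) hrev
  simp only [Polynomial.coe_mul] at hrev
  have e := reverse_denom_mul_impulseResponse G
  have e₁ := reverse_denom_mul_impulseResponse G₁
  have e₂ := reverse_denom_mul_impulseResponse G₂
  have hne : ∀ F : RatFunc ℝ, (F.denom.reverse : PowerSeries ℝ) ≠ 0 := fun F h0 =>
    constantCoeff_reverse_denom_ne_zero F (by rw [h0, map_zero])
  have hX : (PowerSeries.X : PowerSeries ℝ) ^ (G.denom.natDegree - G.num.natDegree) =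
      PowerSeries.X ^ (G₁.denom.natDegree - G₁.num.natDegree) *
      PowerSeries.X ^ (G₂.denom.natDegree - G₂.num.natDegree) := by
    rw [← pow_add]; congr 1; omega
  rw [hX] at e
  refine mul_left_cancel₀ (mul_ne_zero (mul_ne_zero (hne G) (hne G₁)) (hne G₂)) ?_
  linear_combination (G₁.denom.reverse : PowerSeries ℝ) * (G₂.denom.reverse : PowerSeries ℝ) * e
    - (G.denom.reverse : PowerSeries ℝ) * (impulseResponse G₂) *
      (G₂.denom.reverse : PowerSeries ℝ) * e₁
    - (G.denom.reverse : PowerSeries ℝ) * (PowerSeries.X ^ (G₁.denom.natDegree -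
      G₁.num.natDegree) * (G₁.num.reverse : PowerSeries ℝ)) * e₂
    + PowerSeries.X ^ (G₁.denom.natDegree - G₁.num.natDegree) *
      PowerSeries.X ^ (G₂.denom.natDegree - G₂.num.natDegree) * hrev

theorem constantCoeff_impulseResponse {G : RatFunc ℝ} (h : IsStrictlyProper G) :
    PowerSeries.constantCoeff (impulseResponse G) = 0 := by
  rcases eq_or_ne G 0 with rfl | hG
  · simp [impulseResponse_zero]
  rw [isStrictlyProper_iff hG] at h
  simp [impulseResponse, zero_pow (Nat.sub_ne_zero_of_lt h)]

theorem mk_response (G : RatFunc ℝ) (u : ℕ → ℝ) :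
    PowerSeries.mk (response G u) = impulseResponse G * PowerSeries.mk u := by
  ext t
  rw [PowerSeries.coeff_mul, Finset.Nat.sum_antidiagonal_eq_sum_range_succ_mk]
  simp [response]

/-- The impulse response with complex coefficients. -/
def impulseC (G : RatFunc ℝ) : PowerSeries ℂ :=
  PowerSeries.map Complex.ofRealHom (impulseResponse G)

/-- The generating series of a signal, with complex coefficients. -/
def signalSeries (u : ℕ → ℝ) : PowerSeries ℂ :=
  PowerSeries.map Complex.ofRealHom (PowerSeries.mk u)

theorem coeff_signalSeries (u : ℕ → ℝ) (t : ℕ) :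
    PowerSeries.coeff t (signalSeries u) = u t := by
  simp [signalSeries]

theorem signalSeries_response (G : RatFunc ℝ) (u : ℕ → ℝ) :
    signalSeries (response G u) = impulseC G * signalSeries u := by
  rw [signalSeries, mk_response, map_mul]; rfl

theorem impulseC_mul {G₁ G₂ : RatFunc ℝ} (h₁ : IsProper G₁) (h₂ : IsProper G₂) :
    impulseC (G₁ * G₂) = impulseC G₁ * impulseC G₂ := by
  simp [impulseC, impulseResponse_mul h₁ h₂]

theorem constantCoeff_impulseC {G : RatFunc ℝ} (h : IsStrictlyProper G) :
    PowerSeries.constantCoeff (impulseC G) = 0 := by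
  rw [impulseC, ← PowerSeries.coeff_zero_eq_constantCoeff_apply, PowerSeries.coeff_map,
    PowerSeries.coeff_zero_eq_constantCoeff_apply, constantCoeff_impulseResponse h, map_zero]

theorem exists_mul_impulseC_eq (G : RatFunc ℝ) : ∃ P Q : Polynomial ℂ,
    Q.coeff 0 ≠ 0 ∧ (Q : PowerSeries ℂ) * impulseC G = P := by
  obtain ⟨P, Q, hQ, h⟩ := exists_mul_impulseResponse_eq G
  refine ⟨P.map Complex.ofRealHom, Q.map Complex.ofRealHom, by simpa using hQ, ?_⟩
  rw [Polynomial.polynomial_map_coe, Polynomial.polynomial_map_coe, impulseC, ← map_mul, h]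

theorem signalSeries_sum {ι : Type*} (s : Finset ι) (u : ι → ℕ → ℝ) :
    signalSeries (fun t => ∑ i ∈ s, u i t) = ∑ i ∈ s, signalSeries (u i) := by
  ext t
  simp [coeff_signalSeries]

theorem signalSeries_finsupp (d : ℕ →₀ ℝ) :
    ∃ P : Polynomial ℂ, (P : PowerSeries ℂ) = signalSeries d := by
  refine ⟨∑ t ∈ d.support, Polynomial.monomial t (d t : ℂ), ?_⟩
  ext t
  rw [Polynomial.coeff_coe, coeff_signalSeries, Polynomial.finsetSum_coeff]
  simp [Polynomial.coeff_monomial]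
  exact fun h => by rw [h, Complex.ofReal_zero]

/-! ### Coprime bivariate polynomials -/

section Gauss

variable {A : Type*} [CommRing A] [IsDomain A] [UniqueFactorizationMonoid A]

open Polynomial in
/-- Clearing denominators in a polynomial over the fraction field. -/
theorem exists_C_mul_map_eq (A : Type*) [CommRing A] [IsDomain A] (K : Type*) [Field K]
    [Algebra A K] [IsFractionRing A K] (p : K[X]) :
    ∃ (r : A) (q : A[X]), r ≠ 0 ∧ q.map (algebraMap A K) = C (algebraMap A K r) * p := by
  obtain ⟨b, hb₁, hb₂⟩ := IsLocalization.integerNormalization_spec (nonZeroDivisors A) p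
  refine ⟨b, IsLocalization.integerNormalization (nonZeroDivisors A) p,
    nonZeroDivisors.ne_zero hb₁, ?_⟩
  rw [hb₂, ← Polynomial.smul_eq_C_mul, algebraMap_smul]

open Polynomial in
-- Gauss's lemma: up to a unit of K the gcd over K is a primitive polynomial over A, which then
-- divides p and q already over A and so is a unit.
theorem isCoprime_map_of_isRelPrime (K : Type*) [Field K] [Algebra A K] [IsFractionRing A K]
    {p q : A[X]} (hp : p ≠ 0) (h : IsRelPrime p q) :
    IsCoprime (p.map (algebraMap A K)) (q.map (algebraMap A K)) := by
  classical
  let _ : NormalizedGCDMonoid A := Classical.choice inferInstance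
  have hinj : Function.Injective (algebraMap A K) := IsFractionRing.injective A K
  set g := EuclideanDomain.gcd (p.map (algebraMap A K)) (q.map (algebraMap A K)) with hg
  have hgp : g ∣ p.map (algebraMap A K) := EuclideanDomain.gcd_dvd_left _ _
  have hgq : g ∣ q.map (algebraMap A K) := EuclideanDomain.gcd_dvd_right _ _
  rw [← EuclideanDomain.gcd_isUnit_iff, ← hg]
  have hg0 : g ≠ 0 := fun h0 => by
    rw [h0, zero_dvd_iff, Polynomial.map_eq_zero_iff hinj] at hgp
    exact hp hgp
  obtain ⟨r, G, hr, hG⟩ := exists_C_mul_map_eq A K g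
  have hr' : algebraMap A K r ≠ 0 := (map_ne_zero_iff _ hinj).2 hr
  have hG0 : G ≠ 0 := by
    rintro rfl
    rw [Polynomial.map_zero, eq_comm, mul_eq_zero] at hG
    exact hG.elim (by simpa using hr) hg0
  have hassoc : Associated (G.primPart.map (algebraMap A K)) g := by
    have h1 : Associated (G.map (algebraMap A K)) g := by
      rw [hG]
      exact associated_unit_mul_left _ _ (Polynomial.isUnit_C.2 hr'.isUnit)
    refine Associated.trans ?_ h1
    conv_rhs => rw [G.eq_C_content_mul_primPart, Polynomial.map_mul, Polynomial.map_C]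
    refine (associated_unit_mul_left _ _ (Polynomial.isUnit_C.2 ?_)).symm
    exact ((map_ne_zero_iff _ hinj).2 (mt Polynomial.content_eq_zero_iff.1 hG0)).isUnit
  have hprim := G.isPrimitive_primPart
  have h1 : G.primPart ∣ p := hprim.dvd_of_fraction_map_dvd_fraction_map (K := K)
    (hassoc.dvd.trans hgp)
  have h2 : G.primPart ∣ q := hprim.dvd_of_fraction_map_dvd_fraction_map (K := K)
    (hassoc.dvd.trans hgq)
  exact hassoc.isUnit ((h h1 h2).map (Polynomial.mapRingHom (algebraMap A K)))

open Polynomial in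
/-- Relatively prime polynomials over a factorial domain have a nonzero constant in the ideal
that they generate. -/
theorem exists_bezout_of_isRelPrime {p q : A[X]} (hp : p ≠ 0) (h : IsRelPrime p q) :
    ∃ (r : A) (a b : A[X]), r ≠ 0 ∧ a * p + b * q = C r := by
  have hinj : Function.Injective (algebraMap A (FractionRing A)) :=
    IsFractionRing.injective A (FractionRing A)
  obtain ⟨u, v, huv⟩ := isCoprime_map_of_isRelPrime (FractionRing A) hp h
  obtain ⟨r, a, hr, ha⟩ := exists_C_mul_map_eq A (FractionRing A) u
  obtain ⟨s, b, hs, hb⟩ := exists_C_mul_map_eq A (FractionRing A) v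
  refine ⟨r * s, C s * a, C r * b, mul_ne_zero hr hs, ?_⟩
  apply Polynomial.map_injective _ hinj
  simp only [Polynomial.map_add, Polynomial.map_mul, Polynomial.map_C, ha, hb, map_mul]
  linear_combination C (algebraMap A (FractionRing A) r) * C (algebraMap A (FractionRing A) s) * huv

end Gauss

open Polynomial in
/-- Specializing the outer variable of relatively prime bivariate polynomials gives coprime
polynomials, with finitely many exceptions. -/
theorem finite_not_isCoprime_eval {D N : ℂ[X][X]} (hD : D ≠ 0) (h : IsRelPrime D N) :
    {lam : ℂ | ¬ IsCoprime (D.eval (C lam)) (N.eval (C lam))}.Finite := by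
  -- After the swap λ is the coefficient variable, so the Bézout constant r is a nonzero polynomial
  -- in λ alone; only its roots can be exceptional.
  have hswap : IsRelPrime (Bivariate.swap (R := ℂ) D) (Bivariate.swap (R := ℂ) N) := by
    refine IsRelPrime.of_map (Bivariate.swap (R := ℂ)) ?_
    rwa [Bivariate.swap_swap_apply, Bivariate.swap_swap_apply]
  obtain ⟨r, a, b, hr, hab⟩ := exists_bezout_of_isRelPrime
    ((map_ne_zero_iff _ (Bivariate.swap (R := ℂ)).injective).2 hD) hswap
  refine (r.rootSet_finite ℂ).subset fun lam hlam => ?_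
  rw [Polynomial.mem_rootSet]
  refine ⟨hr, by_contra fun hne => hlam ?_⟩
  have key : ∀ p : ℂ[X][X], p.eval (C lam) = (Bivariate.swap (R := ℂ) p).map (evalRingHom lam) := by
    intro p
    induction p using Polynomial.induction_on' with
    | add p q hp hq => simp [eval_add, hp, hq]
    | monomial n f =>
      rw [Bivariate.swap_monomial, eval_monomial, Polynomial.map_mul, Polynomial.map_map,
        Polynomial.map_C, coe_evalRingHom, eval_pow, eval_X, C_pow]
      congr 1
      ext k
      simp
  have hab' := congrArg (Polynomial.map (evalRingHom lam)) hab
  rw [Polynomial.map_add, Polynomial.map_mul, Polynomial.map_mul, ← key, ← key,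
    Polynomial.map_C, coe_evalRingHom] at hab'
  rw [Polynomial.coe_aeval_eq_eval] at hne
  refine ⟨C (r.eval lam)⁻¹ * a.map (evalRingHom lam), C (r.eval lam)⁻¹ * b.map (evalRingHom lam), ?_⟩
  rw [mul_assoc, mul_assoc, ← mul_add, hab', ← C_mul, inv_mul_cancel₀ hne, C_1]

open Polynomial in
/-- A polynomial with coefficients in `ℂ[X]` that is divisible by `X - 1` at infinitely many
constants is divisible by `X - 1`. -/
theorem C_X_sub_one_dvd {N : ℂ[X][X]} {s : Set ℂ} (hs : s.Infinite)
    (h : ∀ lam ∈ s, X - C 1 ∣ N.eval (C lam)) : C (X - C 1) ∣ N := by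
  rw [Polynomial.C_dvd_iff_dvd_coeff]
  -- Setting X = 1 in the coefficients leaves a polynomial in λ that vanishes on the infinite set s.
  have hN : N.map (evalRingHom 1) = 0 := by
    refine Polynomial.eq_zero_of_infinite_isRoot _ (hs.mono fun lam hlam => ?_)
    have := Polynomial.dvd_iff_isRoot.1 (h lam hlam)
    have e := Polynomial.eval₂_at_apply (p := N) (evalRingHom (1 : ℂ)) (C lam)
    simp only [coe_evalRingHom, eval_C] at e
    rw [Set.mem_ofPred_eq, Polynomial.IsRoot, Polynomial.eval_map, e]
    exact this
  intro i
  rw [Polynomial.dvd_iff_isRoot, Polynomial.IsRoot]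
  simpa using congrArg (fun p => Polynomial.coeff p i) hN

open Polynomial in
theorem C_X_sub_one_sq_dvd {N : ℂ[X][X]} {s : Set ℂ} (hs : s.Infinite)
    (h : ∀ lam ∈ s, (X - C 1) ^ 2 ∣ N.eval (C lam)) : C ((X - C 1) ^ 2) ∣ N := by
  obtain ⟨N₁, rfl⟩ := C_X_sub_one_dvd hs fun lam hlam => (dvd_pow_self _ two_ne_zero).trans (h lam hlam)
  have h₁ : ∀ lam ∈ s, X - C 1 ∣ N₁.eval (C lam) := fun lam hlam => by
    have := h lam hlam
    rw [eval_mul, eval_C, pow_two] at this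
    exact (mul_dvd_mul_iff_left (X_sub_C_ne_zero 1)).1 this
  obtain ⟨N₂, rfl⟩ := C_X_sub_one_dvd hs h₁
  exact ⟨N₂, by rw [pow_two, C_mul, mul_assoc]⟩

/-! ### Networks of power series -/

/-- The network equations for generating series, with interconnection matrix `L`. -/
structure IsSeriesNetwork {m : ℕ} {ι : Type} [Fintype ι]
    (G : Matrix (Unit ⊕ Fin m) (Unit ⊕ Fin m) (PowerSeries ℂ)) (L : Matrix ι ι ℂ)
    (W : ι → PowerSeries ℂ) (V : Fin m → ι → PowerSeries ℂ)
    (Y : ι → PowerSeries ℂ) (Z : Fin m → ι → PowerSeries ℂ) : Prop where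
  output : Y = G (Sum.inl ()) (Sum.inl ()) • W + ∑ k, G (Sum.inl ()) (Sum.inr k) • V k
  message : ∀ k, Z k = G (Sum.inr k) (Sum.inl ()) • W + ∑ l, G (Sum.inr k) (Sum.inr l) • V l
  network : ∀ k, V k = (L.map (PowerSeries.C (R := ℂ))).mulVec (Z k)

/-- Linear combinations of the agents that intertwine the interconnection matrices. -/
theorem IsSeriesNetwork.combine {m : ℕ} {ι κ : Type} [Fintype ι] [Fintype κ]
    {G : Matrix (Unit ⊕ Fin m) (Unit ⊕ Fin m) (PowerSeries ℂ)} {L : Matrix ι ι ℂ}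
    {W : ι → PowerSeries ℂ} {V : Fin m → ι → PowerSeries ℂ}
    {Y : ι → PowerSeries ℂ} {Z : Fin m → ι → PowerSeries ℂ}
    (h : IsSeriesNetwork G L W V Y Z) (c : Matrix κ ι ℂ) {L' : Matrix κ κ ℂ}
    (hc : c * L = L' * c) :
    IsSeriesNetwork G L' ((c.map (PowerSeries.C (R := ℂ))).mulVec W)
      (fun k => (c.map (PowerSeries.C (R := ℂ))).mulVec (V k))
      ((c.map (PowerSeries.C (R := ℂ))).mulVec Y)
      (fun k => (c.map (PowerSeries.C (R := ℂ))).mulVec (Z k)) where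
  output := by
    rw [h.output]
    simp only [Matrix.mulVec_add, Matrix.mulVec_smul, Matrix.mulVec_sum]
  message k := by
    rw [h.message]
    simp only [Matrix.mulVec_add, Matrix.mulVec_smul, Matrix.mulVec_sum]
  network k := by
    rw [h.network, Matrix.mulVec_mulVec, Matrix.mulVec_mulVec, ← Matrix.map_mul, hc,
      Matrix.map_mul]

open Polynomial in
-- Evaluating at a matrix commutes with changing the coefficient ring. It is used for three maps:
-- taking the constant term of a series, evaluating X at a point, and embedding polynomials into
-- power series.
theorem map_aeval_matrix {ι R R' S S' : Type*} [Fintype ι] [DecidableEq ι] [CommRing R]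
    [CommRing R'] [CommRing S] [CommRing S'] [Algebra R S] [Algebra R' S'] (τ : R →+* R')
    (ψ : S →+* S') (h : ψ.comp (algebraMap R S) = (algebraMap R' S').comp τ)
    (M : Matrix ι ι S) (p : R[X]) :
    (aeval M p).map ψ = aeval (M.map ψ) (p.map τ) := by
  have := Polynomial.hom_eval₂ p (algebraMap R (Matrix ι ι S)) ψ.mapMatrix M
  rw [Polynomial.aeval_def, Polynomial.aeval_def, Polynomial.eval₂_map]
  refine this.trans ?_
  congr 1
  ext r i j
  have hr := congrArg (fun f : R →+* S' => f r) h
  simp only [RingHom.comp_apply] at hr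
  simp only [RingHom.comp_apply, RingHom.mapMatrix_apply, Matrix.map_apply,
    Matrix.algebraMap_matrix_apply]
  split_ifs
  · exact hr
  · simp

/-- Cramer's rule when the unknowns lie in a module on which the commutative ring of entries acts.
With `networkAction` for φ it solves for the messages while L stays a formal variable. -/
theorem det_apply_eq_sum_adjugate {m : ℕ} {B R V : Type*} [CommRing B] [CommRing R]
    [AddCommGroup V] [Module R V] (φ : B →+* Module.End R V) (M : Matrix (Fin m) (Fin m) B)
    {z b : Fin m → V} (h : ∀ k, ∑ l, φ (M k l) (z l) = b k) (j : Fin m) :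
    φ M.det (z j) = ∑ k, φ (M.adjugate j k) (b k) := by
  have hM := M.adjugate_mul
  calc φ M.det (z j) = ∑ l, φ ((M.adjugate * M) j l) (z l) := by
        rw [hM, Finset.sum_eq_single j]
        · simp
        · intro l _ hl; simp [Matrix.one_apply_ne hl.symm]
        · simp
    _ = ∑ l, ∑ k, φ (M.adjugate j k) (φ (M k l) (z l)) := by
        simp [Matrix.mul_apply, map_sum, LinearMap.sum_apply]
    _ = ∑ k, φ (M.adjugate j k) (b k) := by
        rw [Finset.sum_comm]
        simp [← map_sum, h]

/-- Finitely many rational power series have a common denominator. -/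
theorem exists_common_denominator {ι : Type*} [Fintype ι] {F : ι → PowerSeries ℂ}
    (h : ∀ i, ∃ P Q : Polynomial ℂ, Q.coeff 0 ≠ 0 ∧ (Q : PowerSeries ℂ) * F i = P) :
    ∃ (Q : Polynomial ℂ) (P : ι → Polynomial ℂ), Q.coeff 0 ≠ 0 ∧
      ∀ i, (Q : PowerSeries ℂ) * F i = P i := by
  classical
  choose P Q hQ hPQ using h
  refine ⟨∏ i, Q i, fun i => (∏ j ∈ Finset.univ.erase i, Q j) * P i, ?_, fun i => ?_⟩
  · rw [Polynomial.coeff_zero_eq_eval_zero, Polynomial.eval_prod, Finset.prod_ne_zero_iff]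
    intro i _
    rw [← Polynomial.coeff_zero_eq_eval_zero]
    exact hQ i
  · rw [← Finset.prod_erase_mul _ _ (Finset.mem_univ i), Polynomial.coe_mul, Polynomial.coe_mul,
      mul_assoc, hPQ]

/-- The action of polynomials in the interconnection matrix on vectors of power series. -/
def networkAction {ι : Type} [Fintype ι] [DecidableEq ι] (L : Matrix ι ι ℂ) :
    Polynomial (Polynomial ℂ) →+* Module.End (PowerSeries ℂ) (ι → PowerSeries ℂ) :=
  ((Matrix.toLinAlgEquiv' : Matrix ι ι (PowerSeries ℂ) ≃ₐ[PowerSeries ℂ] _) :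
    Matrix ι ι (PowerSeries ℂ) →+* _).comp
    ((Polynomial.aeval (R := Polynomial ℂ) (L.map (PowerSeries.C (R := ℂ))) :
      _ →ₐ[Polynomial ℂ] Matrix ι ι (PowerSeries ℂ)) : _ →+* Matrix ι ι (PowerSeries ℂ))

section networkAction

variable {ι : Type} [Fintype ι] [DecidableEq ι] (L : Matrix ι ι ℂ)

open Polynomial

theorem networkAction_apply (p : ℂ[X][X]) (v : ι → PowerSeries ℂ) :
    networkAction L p v = (aeval (L.map (PowerSeries.C (R := ℂ))) p).mulVec v := rfl

theorem networkAction_C (p : ℂ[X]) (v : ι → PowerSeries ℂ) :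
    networkAction L (C p) v = (p : PowerSeries ℂ) • v := by
  rw [networkAction_apply, aeval_C, Algebra.algebraMap_eq_smul_one, Matrix.smul_mulVec,
    Matrix.one_mulVec]
  ext i : 1
  simp [Algebra.smul_def, PowerSeries.algebraMap_apply']

theorem networkAction_X (v : ι → PowerSeries ℂ) :
    networkAction L X v = (L.map (PowerSeries.C (R := ℂ))).mulVec v := by
  rw [networkAction_apply, aeval_X]

/-- At X = 0 the polynomial p does not depend on λ, so p(L) has constant term c · 1 whatever L is,
and its determinant is an invertible power series. -/
theorem networkAction_injective {p : ℂ[X][X]} {c : ℂ} (hc : c ≠ 0)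
    (hp : p.map (evalRingHom 0) = C c) : Function.Injective (networkAction L p) := by
  have h : (aeval (L.map (PowerSeries.C (R := ℂ))) p).map (PowerSeries.constantCoeff (R := ℂ)) =
      aeval L (C c) := by
    rw [map_aeval_matrix (evalRingHom 0) (PowerSeries.constantCoeff (R := ℂ)) _ _ p, hp]
    · have hL : (L.map (PowerSeries.C (R := ℂ))).map (PowerSeries.constantCoeff (R := ℂ)) = L := by
        ext i j
        simp
      rw [hL]
    · ext x
      · simp [PowerSeries.algebraMap_apply']
      · simp [PowerSeries.algebraMap_apply']
  have hdet : IsUnit (aeval (L.map (PowerSeries.C (R := ℂ))) p).det := by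
    rw [PowerSeries.isUnit_iff_constantCoeff, RingHom.map_det, RingHom.mapMatrix_apply, h,
      aeval_C, Algebra.algebraMap_eq_smul_one, Matrix.det_smul]
    simp [hc]
  intro v w hvw
  simp only [networkAction_apply] at hvw
  exact Matrix.mulVec_injective_of_isUnit ((Matrix.isUnit_iff_isUnit_det _).2 hdet) hvw

end networkAction

/-! ### Elimination of the messages -/

section

open Polynomial

/-- The matrix `Q (I - λ G²²)` where `P / Q` is the transfer matrix. -/
def loopMatrix {m : ℕ} (Q : ℂ[X]) (P : Matrix (Unit ⊕ Fin m) (Unit ⊕ Fin m) ℂ[X]) :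
    Matrix (Fin m) (Fin m) ℂ[X][X] :=
  Matrix.of fun k l => (if k = l then C Q else 0) - C (P (Sum.inr k) (Sum.inr l)) * X

/-- An unreduced denominator of `G_λ`. -/
def loopDenom {m : ℕ} (Q : ℂ[X]) (P : Matrix (Unit ⊕ Fin m) (Unit ⊕ Fin m) ℂ[X]) : ℂ[X][X] :=
  (loopMatrix Q P).det * C Q

/-- An unreduced numerator of `G_λ`. -/
def loopNum {m : ℕ} (Q : ℂ[X]) (P : Matrix (Unit ⊕ Fin m) (Unit ⊕ Fin m) ℂ[X]) : ℂ[X][X] :=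
  (loopMatrix Q P).det * C (P (Sum.inl ()) (Sum.inl ())) +
    ∑ k, C (P (Sum.inl ()) (Sum.inr k)) * X *
      ∑ j, (loopMatrix Q P).adjugate k j * C (P (Sum.inr j) (Sum.inl ()))

/-- Strict causality of G²² makes the numerators P²² vanish at X = 0, which removes λ: the loop
matrix becomes Q(0) · 1 there. The last factor of the power m + 1 is the extra `C Q` in `loopDenom`.
-/
theorem loopDenom_map {m : ℕ} (Q : ℂ[X]) (P : Matrix (Unit ⊕ Fin m) (Unit ⊕ Fin m) ℂ[X])
    (hP0 : ∀ k l, (P (Sum.inr k) (Sum.inr l)).coeff 0 = 0) :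
    (loopDenom Q P).map (evalRingHom 0) = C (Q.coeff 0 ^ (m + 1)) := by
  have hM : (loopMatrix Q P).map (Polynomial.mapRingHom (evalRingHom 0)) =
      (C (Q.coeff 0) : ℂ[X]) • (1 : Matrix (Fin m) (Fin m) ℂ[X]) := by
    ext1 k l
    by_cases hkl : k = l
    · subst hkl; simp [loopMatrix, ← coeff_zero_eq_eval_zero, hP0]
    · simp [loopMatrix, ← coeff_zero_eq_eval_zero, hP0, hkl]
  have := RingHom.map_det (Polynomial.mapRingHom (evalRingHom (0 : ℂ))) (loopMatrix Q P)
  rw [RingHom.mapMatrix_apply, hM, Matrix.det_smul] at this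
  rw [loopDenom, Polynomial.map_mul, ← Polynomial.coe_mapRingHom, this]
  simp [← coeff_zero_eq_eval_zero, pow_succ]

/-- With V = L Z substituted and denominators cleared, the message equations form a linear system
for Z with matrix `loopMatrix`. Cramer's rule gives det · Z, and inserting it in the output equation
multiplied by det · Q eliminates Z. -/
theorem IsSeriesNetwork.loopDenom_eq {m : ℕ}
    {G : Matrix (Unit ⊕ Fin m) (Unit ⊕ Fin m) (PowerSeries ℂ)} {Q : ℂ[X]}
    {P : Matrix (Unit ⊕ Fin m) (Unit ⊕ Fin m) ℂ[X]}
    (hP : ∀ s s', (Q : PowerSeries ℂ) * G s s' = P s s')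
    {ι : Type} [Fintype ι] [DecidableEq ι] {L : Matrix ι ι ℂ} {W : ι → PowerSeries ℂ}
    {V : Fin m → ι → PowerSeries ℂ} {Y : ι → PowerSeries ℂ} {Z : Fin m → ι → PowerSeries ℂ}
    (h : IsSeriesNetwork G L W V Y Z) :
    networkAction L (loopDenom Q P) Y = networkAction L (loopNum Q P) W := by
  obtain ⟨φ, hφ, hC, hX⟩ : ∃ φ, networkAction L = φ ∧
      (∀ p v, φ (C p) v = (p : PowerSeries ℂ) • v) ∧
      ∀ v, φ X v = (L.map (PowerSeries.C (R := ℂ))).mulVec v :=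
    ⟨_, rfl, networkAction_C L, networkAction_X L⟩
  rw [hφ]
  have hPs : ∀ s s' (v : ι → PowerSeries ℂ),
      (Q : PowerSeries ℂ) • G s s' • v = φ (C (P s s')) v := by
    intro s s' v
    rw [hC, smul_smul, hP s s']
  have hV : ∀ k, V k = φ X (Z k) := fun k => by rw [h.network, hX]
  have hz : ∀ k, ∑ l, φ (loopMatrix Q P k l) (Z l) = φ (C (P (Sum.inr k) (Sum.inl ()))) W := by
    intro k
    have e := congrArg (fun v => (Q : PowerSeries ℂ) • v) (h.message k)
    simp only [smul_add, Finset.smul_sum, hPs] at e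
    rw [← hC] at e
    simp only [loopMatrix, Matrix.of_apply, map_sub, map_mul, LinearMap.sub_apply,
      Finset.sum_sub_distrib, Module.End.mul_apply, ← hV]
    rw [Finset.sum_eq_single k]
    · rw [if_pos rfl, e, add_sub_cancel_right]
    · intro l _ hl; rw [if_neg hl.symm, map_zero, LinearMap.zero_apply]
    · intro hk; exact absurd (Finset.mem_univ k) hk
  have hdet := det_apply_eq_sum_adjugate φ (loopMatrix Q P) hz
  have e := congrArg (fun v => (Q : PowerSeries ℂ) • v) h.output
  simp only [smul_add, Finset.smul_sum, hPs] at e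
  rw [← hC] at e
  rw [loopDenom, loopNum, map_mul, Module.End.mul_apply, e, map_add, map_add, map_mul,
    LinearMap.add_apply, Module.End.mul_apply]
  congr 1
  rw [map_sum, map_sum, LinearMap.sum_apply]
  refine Finset.sum_congr rfl fun k _ => ?_
  have e1 : φ (∑ j, (loopMatrix Q P).adjugate k j * C (P (Sum.inr j) (Sum.inl ()))) W =
      φ (loopMatrix Q P).det (Z k) := by
    rw [hdet k, map_sum, LinearMap.sum_apply]
    refine Finset.sum_congr rfl fun j _ => ?_
    rw [map_mul, Module.End.mul_apply]
  have hmul : ∀ a b v, φ (a * b) v = φ a (φ b v) := fun a b v => by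
    rw [map_mul, Module.End.mul_apply]
  have hcomm : ∀ a b v, φ a (φ b v) = φ b (φ a v) := fun a b v => by
    rw [← hmul, mul_comm, hmul]
  rw [hV k, hmul, hmul, e1, hcomm _ (C _), hcomm _ X]

/-- The transfer function from `W` to `Y` of a network is a reduced fraction `N(L) / D(L)`, with
bivariate polynomials `N` and `D` that do not depend on the network. -/
theorem exists_transfer {m : ℕ} {G : Matrix (Unit ⊕ Fin m) (Unit ⊕ Fin m) (PowerSeries ℂ)}
    (hrat : ∀ s s', ∃ P Q : ℂ[X], Q.coeff 0 ≠ 0 ∧ (Q : PowerSeries ℂ) * G s s' = P)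
    (hstrict : ∀ k l, PowerSeries.constantCoeff (G (Sum.inr k) (Sum.inr l)) = 0) :
    ∃ D N : ℂ[X][X], D ≠ 0 ∧ IsRelPrime D N ∧
      ∀ (ι : Type) [Fintype ι] [DecidableEq ι] (L : Matrix ι ι ℂ) (W : ι → PowerSeries ℂ)
        (V : Fin m → ι → PowerSeries ℂ) (Y : ι → PowerSeries ℂ) (Z : Fin m → ι → PowerSeries ℂ),
        IsSeriesNetwork G L W V Y Z → networkAction L D Y = networkAction L N W := by
  obtain ⟨Q, P', hQ, hP'⟩ := exists_common_denominator
    (F := fun s : (Unit ⊕ Fin m) × (Unit ⊕ Fin m) => G s.1 s.2) fun s => hrat s.1 s.2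
  obtain ⟨P, hP⟩ : ∃ P : Matrix (Unit ⊕ Fin m) (Unit ⊕ Fin m) ℂ[X],
      ∀ s s', (Q : PowerSeries ℂ) * G s s' = P s s' := ⟨fun s s' => P' (s, s'), fun s s' => hP' (s, s')⟩
  have hP0 : ∀ k l, (P (Sum.inr k) (Sum.inr l)).coeff 0 = 0 := by
    intro k l
    have := congrArg PowerSeries.constantCoeff (hP (Sum.inr k) (Sum.inr l))
    simpa [hstrict k l] using this.symm
  have hDt0 := loopDenom_map Q P hP0
  have hDt : loopDenom Q P ≠ 0 := by
    intro h0
    rw [h0, Polynomial.map_zero, eq_comm, C_eq_zero] at hDt0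
    exact pow_ne_zero _ hQ hDt0
  obtain ⟨D, N, g, hrel, hD, hN⟩ :=
    UniqueFactorizationMonoid.exists_reduced_factors (loopDenom Q P) hDt (loopNum Q P)
  -- The common factor g can be cancelled under the action of every L: at X = 0 it divides a nonzero
  -- constant, hence is one itself.
  have hg : ∃ c : ℂ, c ≠ 0 ∧ g.map (evalRingHom 0) = C c := by
    rw [← hD, Polynomial.map_mul] at hDt0
    have hu : IsUnit (g.map (evalRingHom 0)) := by
      refine isUnit_of_mul_isUnit_left (y := D.map (evalRingHom 0)) ?_
      rw [hDt0]
      exact isUnit_C.2 (pow_ne_zero _ hQ).isUnit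
    obtain ⟨c, hc, hcg⟩ := Polynomial.isUnit_iff.1 hu
    exact ⟨c, hc.ne_zero, hcg.symm⟩
  obtain ⟨c, hc, hcg⟩ := hg
  refine ⟨D, N, fun h0 => hDt (by rw [← hD, h0, mul_zero]), hrel, ?_⟩
  intro ι _ _ L W V Y Z h
  apply networkAction_injective L hc hcg
  rw [← Module.End.mul_apply, ← Module.End.mul_apply, ← map_mul, ← map_mul, hD, hN]
  exact h.loopDenom_eq hP

end

/-! ### Spectra of balanced Laplacians -/

theorem mem_spectrum_iff_exists_mulVec {n : ℕ} {M : Matrix (Fin n) (Fin n) ℂ} {μ : ℂ} :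
    μ ∈ spectrum ℂ M ↔ ∃ v ≠ 0, M.mulVec v = μ • v := by
  rw [spectrum.mem_iff, Matrix.isUnit_iff_isUnit_det, isUnit_iff_ne_zero, not_not,
    ← Matrix.exists_mulVec_eq_zero_iff]
  refine exists_congr fun v => and_congr_right fun _ => ?_
  rw [Matrix.sub_mulVec, Algebra.algebraMap_eq_smul_one, Matrix.smul_mulVec, Matrix.one_mulVec,
    sub_eq_zero, eq_comm]

theorem laplacianC_mulVec {n : ℕ} (A : Matrix (Fin n) (Fin n) ℝ) (v : Fin n → ℂ) (i : Fin n) :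
    (laplacianC A).mulVec v i = ∑ j, (A i j : ℂ) * (v i - v j) := by
  have : laplacianC A = Matrix.diagonal (fun i => ∑ j, (A i j : ℂ)) - A.map Complex.ofReal := by
    ext i j
    by_cases h : i = j
    · subst h; simp [laplacianC, laplacian]
    · simp [laplacianC, laplacian, h]
  rw [this, Matrix.sub_mulVec, Pi.sub_apply, Matrix.mulVec_diagonal]
  simp [Matrix.mulVec, dotProduct, mul_sub, Finset.sum_mul]

theorem IsBalancedWeighting.sum_eq {n : ℕ} {N : Digraph (Fin n)} {A : Matrix (Fin n) (Fin n) ℝ}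
    (h : IsBalancedWeighting N A) (j : Fin n) : ∑ i, A i j = ∑ k, A j k := by
  have := h.balanced j
  simp only [laplacian, Matrix.sub_apply, Finset.sum_sub_distrib, Matrix.diagonal_apply] at this
  simp only [Finset.sum_ite_eq', Finset.mem_univ, if_true] at this
  linarith

/-- By Birkhoff's theorem, inequalities for balanced weights follow from those for
permutations. -/
theorem IsBalancedWeighting.sum_nonneg {n : ℕ} {N : Digraph (Fin n)}
    {A : Matrix (Fin n) (Fin n) ℝ} (h : IsBalancedWeighting N A) {φ : Fin n → Fin n → ℝ}
    (hdiag : ∀ i, φ i i = 0) (hφ : ∀ σ : Equiv.Perm (Fin n), 0 ≤ ∑ i, φ i (σ i)) :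
    0 ≤ ∑ i, ∑ j, A i j * φ i j := by
  set s := ∑ i, ∑ j, A i j with hs
  have hs0 : 0 ≤ s := Finset.sum_nonneg fun i _ => Finset.sum_nonneg fun j _ => h.nonneg i j
  have hr : ∀ i, ∑ j, A i j ≤ s := fun i => Finset.single_le_sum (f := fun i => ∑ j, A i j)
    (fun i _ => Finset.sum_nonneg fun j _ => h.nonneg i j) (Finset.mem_univ i)
  -- The diagonal is filled up until all row and column sums equal s, so that B is s times a doubly
  -- stochastic matrix; φ does not see the diagonal.
  let B : Matrix (Fin n) (Fin n) ℝ := A + Matrix.diagonal fun i => s - ∑ j, A i j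
  obtain ⟨M, hM, hB⟩ := (exists_mem_doublyStochastic_eq_smul_iff (M := B) hs0).2 ⟨fun i j => by
      simp only [B, Matrix.add_apply, Matrix.diagonal_apply]
      split_ifs
      · linarith [h.nonneg i j, hr i]
      · linarith [h.nonneg i j], fun i => by
      simp [B, Matrix.diagonal_apply, Finset.sum_add_distrib], fun j => by
      simp [B, Matrix.diagonal_apply, Finset.sum_add_distrib, h.sum_eq j]⟩
  obtain ⟨w, hw0, -, hw⟩ := exists_eq_sum_perm_of_mem_doublyStochastic hM
  have hAB : ∑ i, ∑ j, A i j * φ i j = ∑ i, ∑ j, B i j * φ i j := by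
    refine Finset.sum_congr rfl fun i _ => Finset.sum_congr rfl fun j _ => ?_
    by_cases hij : i = j
    · subst hij; simp [hdiag]
    · simp [B, hij]
  have hBw : ∑ i, ∑ j, B i j * φ i j = s * ∑ σ, w σ * ∑ i, φ i (σ i) := by
    have : ∀ i j, B i j * φ i j = ∑ σ, s * (w σ * if σ i = j then φ i j else 0) := by
      intro i j
      rw [hB, ← hw, Matrix.smul_apply, Matrix.sum_apply, smul_eq_mul, Finset.mul_sum,
        Finset.sum_mul]
      refine Finset.sum_congr rfl fun σ _ => ?_
      rw [Matrix.smul_apply, Equiv.Perm.permMatrix, PEquiv.toMatrix_apply]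
      simp only [Equiv.toPEquiv_apply, Option.mem_some_iff, smul_eq_mul]
      split_ifs <;> ring
    simp only [this]
    rw [Finset.mul_sum]
    calc ∑ i, ∑ j, ∑ σ, s * (w σ * if σ i = j then φ i j else 0)
        = ∑ i, ∑ σ, ∑ j, s * (w σ * if σ i = j then φ i j else 0) :=
          Finset.sum_congr rfl fun i _ => Finset.sum_comm
      _ = ∑ σ, ∑ i, ∑ j, s * (w σ * if σ i = j then φ i j else 0) := Finset.sum_comm
      _ = _ := by
          refine Finset.sum_congr rfl fun σ _ => ?_
          simp [← Finset.mul_sum]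
  rw [hAB, hBw]
  exact mul_nonneg hs0 (Finset.sum_nonneg fun σ _ => mul_nonneg (hw0 σ) (hφ σ))

/-- The numerical range of `1 - P`, for a permutation matrix `P`, lies in a sector. -/
theorem norm_sum_conj_mul_sub_perm_le {n : ℕ} (σ : Equiv.Perm (Fin n)) (v : Fin n → ℂ) :
    ‖∑ i, (starRingEnd ℂ) (v i) * (v i - v (σ i))‖ ≤
      Fintype.card (Equiv.Perm (Fin n)) * ∑ i, ‖v i - v (σ i)‖ ^ 2 := by
  set N := Fintype.card (Equiv.Perm (Fin n)) with hN
  have hN0 : (N : ℂ) ≠ 0 := Nat.cast_ne_zero.2 Fintype.card_ne_zero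
  have hσN : σ ^ N = 1 := pow_card_eq_one
  set e : Fin n → ℂ := fun i => v i - v (σ i) with he
  -- The average of v along the orbits of σ. It is σ-invariant, hence orthogonal to e = v - v ∘ σ,
  -- so v may be replaced by v - q, which telescopes into values of e.
  let q : Fin n → ℂ := fun i => (∑ k ∈ Finset.range N, v ((σ ^ k) i)) / N
  have hq : ∀ i, q (σ i) = q i := by
    intro i
    simp only [q]
    congr 1
    have h1 := Finset.sum_range_succ (fun k => v ((σ ^ k) i)) N
    rw [Finset.sum_range_succ', hσN, pow_zero] at h1
    have h2 : ∀ k, v ((σ ^ k) (σ i)) = v ((σ ^ (k + 1)) i) := fun k => by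
      rw [pow_succ, Equiv.Perm.mul_apply]
    simp only [h2]
    exact add_right_cancel h1
  have horth : ∑ i, (starRingEnd ℂ) (q i) * e i = 0 := by
    simp only [he, mul_sub, Finset.sum_sub_distrib]
    rw [sub_eq_zero, ← Equiv.sum_comp σ (fun i => (starRingEnd ℂ) (q i) * v i)]
    simp only [hq]
  have hbd : ∀ i, ‖v i - q i‖ ≤ ∑ k ∈ Finset.range N, ‖e ((σ ^ k) i)‖ := by
    intro i
    have h1 : ∀ k ≤ N, ‖v i - v ((σ ^ k) i)‖ ≤ ∑ k ∈ Finset.range N, ‖e ((σ ^ k) i)‖ := by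
      intro k hk
      have h2 : v i - v ((σ ^ k) i) = ∑ l ∈ Finset.range k, e ((σ ^ l) i) := by
        have := Finset.sum_range_sub' (fun l => v ((σ ^ l) i)) k
        rw [pow_zero, Equiv.Perm.one_apply] at this
        rw [← this]
        refine Finset.sum_congr rfl fun l _ => ?_
        simp only [he]
        rw [pow_succ', Equiv.Perm.mul_apply]
      rw [h2]
      exact (norm_sum_le _ _).trans (Finset.sum_le_sum_of_subset_of_nonneg
        (Finset.range_subset_range.2 hk) fun _ _ _ => norm_nonneg _)
    have h3 : v i - q i = (∑ k ∈ Finset.range N, (v i - v ((σ ^ k) i))) / N := by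
      simp only [q]
      rw [Finset.sum_sub_distrib, Finset.sum_const, Finset.card_range, nsmul_eq_mul]
      field_simp
    rw [h3, norm_div, Complex.norm_natCast, div_le_iff₀ (by exact_mod_cast Fintype.card_pos)]
    refine (norm_sum_le _ _).trans ((Finset.sum_le_sum fun k hk =>
      h1 k (Finset.mem_range.1 hk).le).trans ?_)
    rw [Finset.sum_const, Finset.card_range, nsmul_eq_mul, mul_comm]
  have hsplit : ∑ i, (starRingEnd ℂ) (v i) * (v i - v (σ i)) =
      ∑ i, (starRingEnd ℂ) (v i - q i) * e i := by
    simp only [map_sub, sub_mul, Finset.sum_sub_distrib]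
    rw [horth, sub_zero]
  rw [hsplit]
  calc ‖∑ i, (starRingEnd ℂ) (v i - q i) * e i‖
      ≤ ∑ i, ‖v i - q i‖ * ‖e i‖ := by
        refine (norm_sum_le _ _).trans (le_of_eq (Finset.sum_congr rfl fun i _ => ?_))
        rw [norm_mul, RCLike.norm_conj]
    _ ≤ ∑ i, ∑ k ∈ Finset.range N, (‖e ((σ ^ k) i)‖ ^ 2 + ‖e i‖ ^ 2) / 2 := by
        refine Finset.sum_le_sum fun i _ => ?_
        refine (mul_le_mul_of_nonneg_right (hbd i) (norm_nonneg _)).trans ?_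
        rw [Finset.sum_mul]
        refine Finset.sum_le_sum fun k _ => ?_
        -- AM-GM; summing over i then removes the shift by σ ^ k.
        nlinarith [sq_nonneg (‖e ((σ ^ k) i)‖ - ‖e i‖)]
    _ = ∑ k ∈ Finset.range N, ∑ i, ‖e i‖ ^ 2 := by
        rw [Finset.sum_comm]
        refine Finset.sum_congr rfl fun k _ => ?_
        rw [← Finset.sum_div, Finset.sum_add_distrib,
          Equiv.sum_comp (σ ^ k) (fun i => ‖e i‖ ^ 2)]
        ring
    _ = N * ∑ i, ‖e i‖ ^ 2 := by
        rw [Finset.sum_const, Finset.card_range, nsmul_eq_mul]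

/-- The constant of the sector that contains the spectra of balanced Laplacians. -/
def sectorConst (n : ℕ) : ℝ := 2 * Fintype.card (Equiv.Perm (Fin n))

theorem sectorConst_pos (n : ℕ) : 0 < sectorConst n :=
  mul_pos two_pos (Nat.cast_pos.2 Fintype.card_pos)

/-- Both parts read off the form v* L v = μ ‖v‖². The real part is an identity because the
differences ‖v i‖² - ‖v j‖² sum to zero along every permutation, hence against balanced weights. The
imaginary part is bounded for permutations by `norm_sum_conj_mul_sub_perm_le`, and `sum_nonneg`
transfers the bound. -/
theorem IsBalancedWeighting.numericalRange {n : ℕ} {N : Digraph (Fin n)}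
    {A : Matrix (Fin n) (Fin n) ℝ} (h : IsBalancedWeighting N A) {v : Fin n → ℂ} {μ : ℂ}
    (hv : (laplacianC A).mulVec v = μ • v) :
    2 * μ.re * ∑ i, ‖v i‖ ^ 2 = ∑ i, ∑ j, A i j * ‖v i - v j‖ ^ 2 ∧
    2 * |μ.im| * ∑ i, ‖v i‖ ^ 2 ≤ sectorConst n * ∑ i, ∑ j, A i j * ‖v i - v j‖ ^ 2 := by
  have hform : μ * ((∑ i, ‖v i‖ ^ 2 : ℝ) : ℂ) =
      ∑ i, ∑ j, (A i j : ℂ) * ((starRingEnd ℂ) (v i) * (v i - v j)) := by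
    rw [Complex.ofReal_sum, Finset.mul_sum]
    refine Finset.sum_congr rfl fun i _ => ?_
    have hi := congrFun hv i
    rw [laplacianC_mulVec, Pi.smul_apply, smul_eq_mul] at hi
    have hn : ((‖v i‖ ^ 2 : ℝ) : ℂ) = (starRingEnd ℂ) (v i) * v i := by
      rw [← Complex.normSq_eq_conj_mul_self, Complex.normSq_eq_norm_sq]
    rw [hn]
    calc μ * ((starRingEnd ℂ) (v i) * v i) = (starRingEnd ℂ) (v i) * (μ * v i) := by ring
      _ = _ := by
        rw [← hi, Finset.mul_sum]
        exact Finset.sum_congr rfl fun j _ => by ring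
  have hre : μ.re * ∑ i, ‖v i‖ ^ 2 =
      ∑ i, ∑ j, A i j * ((starRingEnd ℂ) (v i) * (v i - v j)).re := by
    have := congrArg Complex.re hform
    rw [Complex.re_mul_ofReal] at this
    simpa only [Complex.re_sum, Complex.re_ofReal_mul] using this
  have him : μ.im * ∑ i, ‖v i‖ ^ 2 =
      ∑ i, ∑ j, A i j * ((starRingEnd ℂ) (v i) * (v i - v j)).im := by
    have := congrArg Complex.im hform
    rw [Complex.im_mul_ofReal] at this
    simpa only [Complex.im_sum, Complex.im_ofReal_mul] using this
  constructor
  · have hid : ∀ i j, 2 * ((starRingEnd ℂ) (v i) * (v i - v j)).re - ‖v i - v j‖ ^ 2 =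
        ‖v i‖ ^ 2 - ‖v j‖ ^ 2 := by
      intro i j
      simp only [← Complex.normSq_eq_norm_sq, Complex.normSq_apply, Complex.mul_re,
        Complex.conj_re, Complex.conj_im, Complex.sub_re, Complex.sub_im]
      ring
    have hperm : ∀ σ : Equiv.Perm (Fin n), ∑ i, (‖v i‖ ^ 2 - ‖v (σ i)‖ ^ 2) = 0 := fun σ => by
      rw [Finset.sum_sub_distrib, Equiv.sum_comp σ (fun i => ‖v i‖ ^ 2), sub_self]
    have h1 := h.sum_nonneg (φ := fun i j => ‖v i‖ ^ 2 - ‖v j‖ ^ 2) (by simp)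
      fun σ => (hperm σ).ge
    have h2 := h.sum_nonneg (φ := fun i j => -(‖v i‖ ^ 2 - ‖v j‖ ^ 2)) (by simp) fun σ => by
      rw [Finset.sum_neg_distrib, hperm σ, neg_zero]
    simp only [← hid, mul_sub, neg_sub, Finset.sum_sub_distrib] at h1 h2
    have h3 : ∑ i, ∑ j, A i j * (2 * ((starRingEnd ℂ) (v i) * (v i - v j)).re) =
        2 * (μ.re * ∑ i, ‖v i‖ ^ 2) := by
      rw [hre, Finset.mul_sum]
      refine Finset.sum_congr rfl fun i _ => ?_
      rw [Finset.mul_sum]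
      exact Finset.sum_congr rfl fun j _ => by ring
    simp only [mul_sub] at h3
    linarith
  · set K : ℝ := (Fintype.card (Equiv.Perm (Fin n)) : ℝ) with hK
    -- The sign s = ±1 turns the bound on |Im μ| into two inequalities linear in the weights, as
    -- Birkhoff's theorem requires.
    have key : ∀ s : ℝ, |s| = 1 → s * (μ.im * ∑ i, ‖v i‖ ^ 2) ≤
        K * ∑ i, ∑ j, A i j * ‖v i - v j‖ ^ 2 := by
      intro s hs
      have h1 := h.sum_nonneg (φ := fun i j => K * ‖v i - v j‖ ^ 2 -
        s * ((starRingEnd ℂ) (v i) * (v i - v j)).im) (by simp) fun σ => by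
          have := norm_sum_conj_mul_sub_perm_le σ v
          rw [Finset.sum_sub_distrib, ← Finset.mul_sum, ← Finset.mul_sum, ← Complex.im_sum,
            sub_nonneg]
          refine le_trans (le_abs_self _) ?_
          rw [abs_mul, hs, one_mul]
          exact (Complex.abs_im_le_norm _).trans this
      have h2 : ∑ i, ∑ j, A i j * (K * ‖v i - v j‖ ^ 2 -
          s * ((starRingEnd ℂ) (v i) * (v i - v j)).im) =
          K * ∑ i, ∑ j, A i j * ‖v i - v j‖ ^ 2 - s * (μ.im * ∑ i, ‖v i‖ ^ 2) := by
        rw [him, Finset.mul_sum, Finset.mul_sum, ← Finset.sum_sub_distrib]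
        refine Finset.sum_congr rfl fun i _ => ?_
        rw [Finset.mul_sum, Finset.mul_sum, ← Finset.sum_sub_distrib]
        exact Finset.sum_congr rfl fun j _ => by ring
      linarith
    have hS : 0 ≤ ∑ i, ‖v i‖ ^ 2 := Finset.sum_nonneg fun i _ => by positivity
    rw [sectorConst, ← hK]
    rcases abs_cases μ.im with ⟨he, _⟩ | ⟨he, _⟩
    · have := key 1 (by simp)
      rw [he]; linarith
    · have := key (-1) (by simp)
      rw [he]; linarith

theorem sum_norm_sq_pos {n : ℕ} {v : Fin n → ℂ} (hv : v ≠ 0) : 0 < ∑ i, ‖v i‖ ^ 2 := by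
  obtain ⟨i, hi⟩ := Function.ne_iff.1 hv
  exact Finset.sum_pos' (fun i _ => by positivity)
    ⟨i, Finset.mem_univ i, by have := norm_pos_iff.2 hi; positivity⟩

/-- The spectrum of a balanced Laplacian lies in a sector. -/
theorem IsBalancedWeighting.abs_im_le {n : ℕ} {N : Digraph (Fin n)}
    {A : Matrix (Fin n) (Fin n) ℝ} (h : IsBalancedWeighting N A) {v : Fin n → ℂ} {μ : ℂ}
    (hv0 : v ≠ 0) (hv : (laplacianC A).mulVec v = μ • v) :
    |μ.im| ≤ sectorConst n * μ.re := by
  obtain ⟨h1, h2⟩ := h.numericalRange hv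
  have hS := sum_norm_sq_pos hv0
  rw [← h1] at h2
  have : |μ.im| * ∑ i, ‖v i‖ ^ 2 ≤ (sectorConst n * μ.re) * ∑ i, ‖v i‖ ^ 2 := by linarith
  exact le_of_mul_le_mul_right this hS

/-- On a connected network only constant vectors belong to imaginary eigenvalues. -/
theorem IsBalancedWeighting.eq_of_re_eq_zero {n : ℕ} {N : Digraph (Fin n)}
    {A : Matrix (Fin n) (Fin n) ℝ} (h : IsBalancedWeighting N A) (hN : IsConnected N)
    {v : Fin n → ℂ} {μ : ℂ} (hv : (laplacianC A).mulVec v = μ • v) (hμ : μ.re = 0)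
    (i j : Fin n) : v i = v j := by
  obtain ⟨h1, -⟩ := h.numericalRange hv
  rw [hμ, mul_zero, zero_mul, eq_comm] at h1
  have hnn : ∀ i j, 0 ≤ A i j * ‖v i - v j‖ ^ 2 := fun i j =>
    mul_nonneg (h.nonneg i j) (by positivity)
  have hz : ∀ i j, A i j * ‖v i - v j‖ ^ 2 = 0 := by
    intro i j
    have h2 := (Finset.sum_eq_zero_iff_of_nonneg
      fun i _ => Finset.sum_nonneg fun j _ => hnn i j).1 h1 i (Finset.mem_univ i)
    exact (Finset.sum_eq_zero_iff_of_nonneg fun j _ => hnn i j).1 h2 j (Finset.mem_univ j)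
  induction hN i j with
  | refl => rfl
  | tail _ hadj ih =>
    rw [ih]
    have h3 := (mul_eq_zero.1 (hz _ _)).resolve_left ((h.support _ _).2 hadj)
    rwa [sq_eq_zero_iff, norm_eq_zero, sub_eq_zero] at h3

/-! ### Circulant weights on the complete network -/

/-- Uniform weights `b` plus a directed cycle of weight `a`. -/
def cycleWeights (k : ℕ) (a b : ℝ) : Matrix (Fin (k + 1)) (Fin (k + 1)) ℝ :=
  Matrix.of fun i j => b + if i + 1 = j then a else 0

section cycleWeights

variable {k : ℕ} {a b : ℝ}

theorem ofReal_cycleWeights (i j : Fin (k + 1)) :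
    (cycleWeights k a b i j : ℂ) = b + if i + 1 = j then (a : ℂ) else 0 := by
  rw [cycleWeights, Matrix.of_apply]
  split_ifs <;> simp

theorem sum_cycleWeights_row (i : Fin (k + 1)) :
    ∑ j, cycleWeights k a b i j = (k + 1) * b + a := by
  simp [cycleWeights, Finset.sum_add_distrib]

theorem sum_cycleWeights_col (j : Fin (k + 1)) :
    ∑ i, cycleWeights k a b i j = (k + 1) * b + a := by
  simp [cycleWeights, Finset.sum_add_distrib, ← eq_sub_iff_add_eq]

theorem isBalancedWeighting_cycleWeights (ha : 0 ≤ a) (hb : 0 < b) :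
    IsBalancedWeighting ⊤ (cycleWeights k a b) where
  nonneg i j := by
    simp only [cycleWeights, Matrix.of_apply]
    split_ifs <;> linarith
  support i j := by
    simp only [cycleWeights, Matrix.of_apply]
    refine ⟨fun _ => by simp, fun _ => ?_⟩
    split_ifs <;> positivity
  balanced j := by
    simp only [laplacian, Matrix.sub_apply, Finset.sum_sub_distrib, sum_cycleWeights_col,
      sum_cycleWeights_row, Matrix.diagonal_apply]
    simp

/-- Gershgorin's argument: the eigenvector equation is read at an entry of maximal modulus. -/
theorem norm_le_of_mem_spectrum_cycleWeights (ha : 0 ≤ a) (hb : 0 < b) {μ : ℂ}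
    (hμ : μ ∈ spectrum ℂ (laplacianC (cycleWeights k a b))) :
    ‖μ‖ ≤ 2 * ((k + 1) * b + a) := by
  obtain ⟨v, hv0, hv⟩ := mem_spectrum_iff_exists_mulVec.1 hμ
  obtain ⟨i, -, hi⟩ := Finset.exists_max_image Finset.univ (fun i => ‖v i‖) Finset.univ_nonempty
  have hpos : 0 < ‖v i‖ := by
    obtain ⟨j, hj⟩ := Function.ne_iff.1 hv0
    exact (norm_pos_iff.2 hj).trans_le (hi j (Finset.mem_univ j))
  have hA := (isBalancedWeighting_cycleWeights (k := k) ha hb).nonneg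
  have h1 := congrFun hv i
  rw [laplacianC_mulVec, Pi.smul_apply, smul_eq_mul] at h1
  have h2 : ‖μ‖ * ‖v i‖ ≤ (2 * ((k + 1) * b + a)) * ‖v i‖ := by
    rw [← norm_mul, ← h1, ← sum_cycleWeights_row (k := k) (a := a) (b := b) i]
    refine (norm_sum_le _ _).trans ?_
    rw [Finset.mul_sum, Finset.sum_mul]
    refine Finset.sum_le_sum fun j _ => ?_
    rw [norm_mul, Complex.norm_of_nonneg (hA i j)]
    have : ‖v i - v j‖ ≤ 2 * ‖v i‖ := by
      have := norm_sub_le (v i) (v j)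
      have := hi j (Finset.mem_univ j)
      linarith
    calc _ ≤ cycleWeights k a b i j * (2 * ‖v i‖) := mul_le_mul_of_nonneg_left this (hA i j)
      _ = _ := by ring
  exact le_of_mul_le_mul_right h2 hpos

/-- Addition in `Fin (k + 1)` wraps around, which is harmless for a (k + 1)-st root of unity. -/
theorem pow_val_add_one {x : ℂ} (hx : x ^ (k + 1) = 1) (i : Fin (k + 1)) :
    x ^ ((i + 1 : Fin (k + 1)) : ℕ) = x ^ (i : ℕ) * x := by
  rw [← pow_succ, pow_eq_pow_mod ((i : ℕ) + 1) hx, Fin.val_add, Fin.val_one']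
  simp

theorem sum_pow_eq_zero {x : ℂ} (hx : x ^ (k + 1) = 1) (hx1 : x ≠ 1) :
    ∑ i : Fin (k + 1), x ^ (i : ℕ) = 0 := by
  rw [Fin.sum_univ_eq_sum_range (fun i => x ^ i)]
  have := mul_geom_sum x (k + 1)
  rw [hx, sub_self] at this
  exact (mul_eq_zero.1 this).resolve_left (sub_ne_zero.2 hx1)

/-- Fourier vectors diagonalize circulant matrices. The power sum stays unevaluated so that one
formula also covers x = 1. -/
theorem laplacianC_cycleWeights_mulVec {x : ℂ} (hx : x ^ (k + 1) = 1) :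
    (laplacianC (cycleWeights k a b)).mulVec (fun i => x ^ (i : ℕ)) =
      (((k + 1) * b + a : ℂ) - b * (∑ i : Fin (k + 1), x ^ (i : ℕ)) - a * x) •
        fun i : Fin (k + 1) => x ^ (i : ℕ) := by
  ext i
  have hrow : ∑ j, (cycleWeights k a b i j : ℂ) = (k + 1) * b + a := by
    rw [← Complex.ofReal_sum, sum_cycleWeights_row]; simp
  rw [laplacianC_mulVec]
  simp only [mul_sub, Finset.sum_sub_distrib, ← Finset.sum_mul, hrow, Pi.smul_apply, smul_eq_mul]
  have h2 : ∑ j, (cycleWeights k a b i j : ℂ) * x ^ (j : ℕ) =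
      b * (∑ i : Fin (k + 1), x ^ (i : ℕ)) + a * (x ^ (i : ℕ) * x) := by
    rw [← pow_val_add_one hx]
    simp [ofReal_cycleWeights, add_mul, Finset.sum_add_distrib, Finset.mul_sum]
  rw [h2]
  rcases eq_or_ne x 1 with rfl | hx1
  · simp; ring
  · rw [sum_pow_eq_zero hx hx1]; ring

/-- The Fourier vectors are the columns of the transposed Vandermonde matrix of the distinct (k +
1)-st roots of unity, which is invertible. -/
theorem isDiagonalizable_cycleWeights : IsDiagonalizable (laplacianC (cycleWeights k a b)) := by
  set x : ℂ := Complex.exp (2 * Real.pi * Complex.I / (k + 1 : ℕ)) with hx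
  have hprim : IsPrimitiveRoot x (k + 1) := Complex.isPrimitiveRoot_exp (k + 1) k.succ_ne_zero
  have hpow : ∀ j : Fin (k + 1), (x ^ (j : ℕ)) ^ (k + 1) = 1 := fun j => by
    rw [← pow_mul, mul_comm, pow_mul, hprim.pow_eq_one, one_pow]
  refine ⟨(Matrix.vandermonde fun j : Fin (k + 1) => x ^ (j : ℕ)).transpose,
    fun j => ((k + 1) * b + a : ℂ) - b * (∑ i : Fin (k + 1), (x ^ (j : ℕ)) ^ (i : ℕ)) -
      a * x ^ (j : ℕ), ?_, ?_⟩
  · rw [Matrix.isUnit_iff_isUnit_det, Matrix.det_transpose, isUnit_iff_ne_zero,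
      Matrix.det_vandermonde_ne_zero_iff]
    intro i j hij
    exact Fin.ext (hprim.pow_inj i.2 j.2 hij)
  · ext i j
    have := congrFun (laplacianC_cycleWeights_mulVec (a := a) (b := b) (hpow j)) i
    rw [Matrix.mul_diagonal, Matrix.transpose_apply, Matrix.vandermonde_apply, mul_comm]
    exact this

/-- Left eigenvectors are the ones needed: they combine the agents' equations into a scalar system
with λ in place of L. The cycle is then run backwards, whence x⁻¹. -/
theorem vecMul_laplacianC_cycleWeights {x : ℂ} (hx : x ^ (k + 1) = 1) (hx1 : x ≠ 1) :
    Matrix.vecMul (fun i : Fin (k + 1) => x ^ (i : ℕ)) (laplacianC (cycleWeights k a b)) =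
      (((k + 1) * b + a : ℂ) - a * x⁻¹) • fun i : Fin (k + 1) => x ^ (i : ℕ) := by
  have hx0 : x ≠ 0 := by rintro rfl; simp at hx
  ext j
  have h1 : laplacianC (cycleWeights k a b) = Matrix.diagonal (fun _ => ((k + 1) * b + a : ℂ)) -
      (cycleWeights k a b).map Complex.ofReal := by
    ext i j
    by_cases h : i = j
    · subst h; simp [laplacianC, laplacian, sum_cycleWeights_row]
    · simp [laplacianC, laplacian, h]
  rw [h1, Matrix.vecMul_sub, Pi.sub_apply, Matrix.vecMul_diagonal, Pi.smul_apply, smul_eq_mul]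
  have h2 : Matrix.vecMul (fun i : Fin (k + 1) => x ^ (i : ℕ))
      ((cycleWeights k a b).map Complex.ofReal) j = a * x⁻¹ * x ^ (j : ℕ) := by
    have h3 : x ^ ((j - 1 : Fin (k + 1)) : ℕ) = x⁻¹ * x ^ (j : ℕ) := by
      have := pow_val_add_one hx (j - 1)
      rw [sub_add_cancel] at this
      rw [this]; field_simp
    rw [mul_assoc, ← h3]
    simp [Matrix.vecMul, dotProduct, ofReal_cycleWeights, mul_add, Finset.sum_add_distrib,
      ← eq_sub_iff_add_eq, mul_comm]
    rw [← Finset.mul_sum, sum_pow_eq_zero hx hx1, mul_zero]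
  rw [h2]; ring

end cycleWeights

/-- As θ → 0, 1 - cos θ is of order θ² and sin θ of order θ, so a long directed cycle has
eigenvalues close to the imaginary direction. -/
theorem exists_angle (C : ℝ) (hC : 0 < C) : ∃ k : ℕ, 0 < k ∧
    0 < Real.sin (2 * Real.pi / (k + 1 : ℕ)) ∧
    C * (1 - Real.cos (2 * Real.pi / (k + 1 : ℕ))) < Real.sin (2 * Real.pi / (k + 1 : ℕ)) := by
  -- k > 3 puts θ in [0, π/2], where sin θ ≥ 2θ/π; k > C π² gives C π θ < 2, more than enough
  -- against 1 - cos θ ≤ θ²/2.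
  obtain ⟨k, hk⟩ := exists_nat_gt (max 3 (C * Real.pi ^ 2))
  have hk3 : (3 : ℝ) < k := (le_max_left _ _).trans_lt hk
  have hkC : C * Real.pi ^ 2 < k := (le_max_right _ _).trans_lt hk
  have hpi := Real.pi_pos
  refine ⟨k, by exact_mod_cast (zero_lt_three.trans hk3), ?_⟩
  set θ := 2 * Real.pi / (k + 1 : ℕ) with hθ
  have hk1 : (0 : ℝ) < (k + 1 : ℕ) := by positivity
  have hθ0 : 0 < θ := by positivity
  have hθk : θ * (k + 1) = 2 * Real.pi := by
    rw [hθ]; push_cast; field_simp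
  have hθ1 : θ ≤ Real.pi / 2 := by
    by_contra hlt
    nlinarith
  have hsin := Real.mul_le_sin hθ0.le hθ1
  have hcos := Real.one_sub_sq_div_two_le_cos (x := θ)
  have hθC : C * Real.pi * θ < 2 := by
    by_contra hlt
    have h1 : C * Real.pi * θ * (k + 1) = 2 * (C * Real.pi ^ 2) := by
      rw [mul_assoc, hθk]; ring
    nlinarith
  have hlow : 0 < 2 / Real.pi * θ := by positivity
  refine ⟨hlow.trans_le hsin, lt_of_le_of_lt (b := C * (θ ^ 2 / 2)) ?_ (lt_of_lt_of_le ?_ hsin)⟩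
  · exact mul_le_mul_of_nonneg_left (by linarith) hC.le
  · rw [div_mul_eq_mul_div, lt_div_iff₀ hpi]
    nlinarith

/-- Every point of a sector is an eigenvalue of a diagonalizable balanced Laplacian on a complete
network of fixed size. -/
theorem exists_diagonalizable_laplacian (C : ℝ) (hC : 0 < C) : ∃ (n : ℕ) (K : ℝ), 0 < K ∧
    ∀ lam : ℂ, 0 < lam.re → |lam.im| ≤ C * lam.re → ∃ A : Matrix (Fin n) (Fin n) ℝ,
      IsBalancedWeighting ⊤ A ∧ IsDiagonalizable (laplacianC A) ∧
      (∀ μ ∈ spectrum ℂ (laplacianC A), ‖μ‖ ≤ K * lam.re) ∧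
      ∃ c : Fin n → ℂ, Matrix.vecMul c (laplacianC A) = lam • c ∧ ∃ i j, c i ≠ c j := by
  obtain ⟨k, hk0, hsin, hcos⟩ := exists_angle C hC
  set θ := 2 * Real.pi / (k + 1 : ℕ) with hθ
  refine ⟨k + 1, 2 * (1 + C / Real.sin θ), by positivity, fun lam hre him => ?_⟩
  -- a and b solve (k + 1) b + a - a x⁻¹ = λ for x = exp(± i θ): the imaginary part fixes a, the
  -- real part then fixes b, and the choice of θ makes b positive throughout the sector. The sign in
  -- x is that of Im λ.
  set a := |lam.im| / Real.sin θ with ha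
  set b := (lam.re - a * (1 - Real.cos θ)) / (k + 1) with hb
  have ha0 : 0 ≤ a := by positivity
  have hasin : a * Real.sin θ = |lam.im| := by rw [ha]; field_simp
  have hc1 : 0 ≤ 1 - Real.cos θ := sub_nonneg.2 (Real.cos_le_one θ)
  have hnum : 0 < lam.re - a * (1 - Real.cos θ) := by
    rw [sub_pos, ha, div_mul_eq_mul_div, div_lt_iff₀ hsin]
    calc |lam.im| * (1 - Real.cos θ) ≤ C * lam.re * (1 - Real.cos θ) :=
          mul_le_mul_of_nonneg_right him hc1
      _ = lam.re * (C * (1 - Real.cos θ)) := by ring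
      _ < _ := mul_lt_mul_of_pos_left hcos hre
  have hb0 : 0 < b := by positivity
  have hkb : (k + 1) * b = lam.re - a * (1 - Real.cos θ) := by
    rw [hb]; field_simp
  have hprim : IsPrimitiveRoot (Complex.exp (θ * Complex.I)) (k + 1) := by
    have := Complex.isPrimitiveRoot_exp (k + 1) k.succ_ne_zero
    convert this using 2
    rw [hθ]; push_cast; ring
  obtain ⟨x, hx, hxinv⟩ : ∃ x : ℂ, IsPrimitiveRoot x (k + 1) ∧
      lam = ((k + 1) * b + a : ℂ) - a * x⁻¹ := by
    have hkbC : ((k + 1) * b : ℂ) = lam.re - a * (1 - Real.cos θ) := by exact_mod_cast hkb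
    rcases abs_cases lam.im with ⟨he, _⟩ | ⟨he, _⟩
    · refine ⟨_, hprim, ?_⟩
      rw [hkbC, ← Complex.exp_neg, ← neg_mul, ← Complex.ofReal_neg, Complex.exp_mul_I,
        ← Complex.ofReal_cos, ← Complex.ofReal_sin, Real.cos_neg, Real.sin_neg]
      apply Complex.ext
      · simp [-Complex.ofReal_cos, -Complex.ofReal_sin]; ring
      · simp [-Complex.ofReal_cos, -Complex.ofReal_sin]; rw [hasin, he]
    · refine ⟨_, hprim.inv, ?_⟩
      rw [hkbC, inv_inv, Complex.exp_mul_I, ← Complex.ofReal_cos, ← Complex.ofReal_sin]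
      apply Complex.ext
      · simp [-Complex.ofReal_cos, -Complex.ofReal_sin]; ring
      · simp [-Complex.ofReal_cos, -Complex.ofReal_sin]; rw [hasin, he, neg_neg]
  have hx1 : x ≠ 1 := hx.ne_one (by omega)
  refine ⟨cycleWeights k a b, isBalancedWeighting_cycleWeights ha0 hb0,
    isDiagonalizable_cycleWeights, fun μ hμ => ?_, fun i => x ^ (i : ℕ), ?_, 0, 1, ?_⟩
  · refine (norm_le_of_mem_spectrum_cycleWeights ha0 hb0 hμ).trans ?_
    have h1 : a ≤ C / Real.sin θ * lam.re := by
      rw [ha, div_mul_eq_mul_div]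
      exact div_le_div_of_nonneg_right him hsin.le
    have h2 : (k + 1) * b ≤ lam.re := by
      rw [hkb]; nlinarith
    linarith
  · rw [vecMul_laplacianC_cycleWeights hx.pow_eq_one hx1, ← hxinv]
  · have h1 : ((1 : Fin (k + 1)) : ℕ) = 1 := by
      rw [Fin.val_one', Nat.mod_eq_of_lt (by omega)]
    change x ^ ((0 : Fin (k + 1)) : ℕ) ≠ x ^ ((1 : Fin (k + 1)) : ℕ)
    rw [h1, pow_one, Fin.val_zero, pow_zero]
    exact hx1.symm

section

open Polynomial

/-! ### Consequences of the consensus and optimization hypotheses -/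

/-- `isStable_of_vanishing` applied after reducing the fraction. The cancelled factor g is kept,
since it must contain every factor of Q with a root in the disk. -/
theorem exists_isStable_of_vanishing {P Q : ℂ[X]} (hQ : Q ≠ 0) {F : PowerSeries ℂ}
    (h : (Q : PowerSeries ℂ) * F = P) (hF : Vanishing F) : ∃ P' Q' g : ℂ[X],
      IsStable Q' ∧ g * P' = P ∧ g * Q' = Q ∧ (Q' : PowerSeries ℂ) * F = P' := by
  obtain ⟨Q', P', g, hrel, rfl, rfl⟩ := UniqueFactorizationMonoid.exists_reduced_factors Q hQ P
  have hg : (g : PowerSeries ℂ) ≠ 0 := by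
    rw [Ne, Polynomial.coe_eq_zero_iff]
    rintro rfl
    simp at hQ
  have h' : (Q' : PowerSeries ℂ) * F = P' := by
    refine mul_left_cancel₀ hg ?_
    rw [← mul_assoc, ← Polynomial.coe_mul, h, Polynomial.coe_mul]
  exact ⟨P', Q', g, isStable_of_vanishing hrel.isCoprime.symm h' hF, rfl, rfl, h'⟩

/-- A system that tracks ramps is stable with a double zero at `1`. -/
theorem isStable_and_dvd_of_ramp {D N : ℂ[X]} (hD : D ≠ 0) (hDN : IsCoprime D N)
    {F S : PowerSeries ℂ} (hS : (((X - C 1) ^ 2 : ℂ[X]) : PowerSeries ℂ) * S = 1)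
    (h : (D : PowerSeries ℂ) * F = N * S) (hF : Vanishing F) :
    IsStable D ∧ (X - C 1) ^ 2 ∣ N := by
  have h1 : (D : PowerSeries ℂ) * ((((X - C 1) ^ 2 : ℂ[X]) : PowerSeries ℂ) * F) = N := by
    linear_combination (((X - C 1) ^ 2 : ℂ[X]) : PowerSeries ℂ) * h + (N : PowerSeries ℂ) * hS
  refine ⟨isStable_of_vanishing hDN.symm h1 (hF.coe_mul _), ?_⟩
  have h2 : ((((X - C 1) ^ 2 * D : ℂ[X])) : PowerSeries ℂ) * F = N := by
    rw [Polynomial.coe_mul, ← h1]; ring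
  obtain ⟨P', Q', g, hst, hN, hQ, -⟩ := exists_isStable_of_vanishing
    (mul_ne_zero (pow_ne_zero 2 (X_sub_C_ne_zero 1)) hD) h2 hF
  -- The reduced denominator Q' does not vanish at 1, so the double factor of (X - 1)² D must lie in
  -- the cancelled part g, which divides N.
  have hcop : IsCoprime ((X - C 1) ^ 2 : ℂ[X]) Q' := by
    refine IsCoprime.pow_left ?_
    rw [(irreducible_X_sub_C (1 : ℂ)).coprime_iff_not_dvd, dvd_iff_isRoot]
    exact hst 1 (by simp)
  have : (X - C 1) ^ 2 ∣ g := hcop.dvd_of_dvd_mul_right (by rw [hQ]; exact dvd_mul_right _ _)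
  exact this.trans (by rw [← hN]; exact dvd_mul_right _ _)

/-- The generating series of a network trajectory. -/
theorem IsNetworkTrajectory.isSeriesNetwork {m n : ℕ} {G : AgentSystem m}
    {A : Matrix (Fin n) (Fin n) ℝ} {w : Fin n → ℕ → ℝ} {v : Fin n → Fin m → ℕ → ℝ}
    {y : Fin n → ℕ → ℝ} {z : Fin n → Fin m → ℕ → ℝ} (h : IsNetworkTrajectory G A w v y z) :
    IsSeriesNetwork (G.map impulseC) (laplacianC A) (fun i => signalSeries (w i))
      (fun k i => signalSeries (v i k)) (fun i => signalSeries (y i))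
      (fun k i => signalSeries (z i k)) := by
  have key : ∀ i s, signalSeries (Sum.elim (fun _ => y i) (z i) s) =
      impulseC (G s (Sum.inl ())) * signalSeries (w i) +
        ∑ l, impulseC (G s (Sum.inr l)) * signalSeries (v i l) := by
    intro i s
    rw [h.system i]
    unfold matrixResponse
    rw [signalSeries_sum, Fintype.sum_sum_type]
    simp [signalSeries_response]
  refine ⟨?_, fun k => ?_, fun k => ?_⟩
  · ext i : 1
    simpa using key i (Sum.inl ())
  · ext i : 1
    simpa using key i (Sum.inr k)
  · ext i t
    have h1 := laplacianC_mulVec A (fun j => (z j k t : ℂ)) i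
    rw [coeff_signalSeries, h.network]
    simp only [Matrix.mulVec, dotProduct, Matrix.map_apply, map_sum, PowerSeries.coeff_C_mul,
      coeff_signalSeries] at h1 ⊢
    rw [h1]
    push_cast
    rfl

/-- A network of one virtual agent with interconnection λ: this is where a left eigenvector sends
the network equations. -/
theorem networkAction_unit (lam : ℂ) (p : ℂ[X][X]) (F : PowerSeries ℂ) :
    networkAction (Matrix.of fun _ _ : Unit => lam) p (fun _ => F) =
      fun _ => ((p.eval (C lam) : ℂ[X]) : PowerSeries ℂ) * F := by
  induction p using Polynomial.induction_on' with
  | add p q hp hq =>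
    rw [map_add, LinearMap.add_apply, hp, hq, eval_add]
    ext i : 1
    simp [add_mul]
  | monomial k f =>
    rw [← C_mul_X_pow_eq_monomial, eval_mul, eval_C, eval_pow, eval_X, map_mul,
      Module.End.mul_apply, networkAction_C]
    have : networkAction (Matrix.of fun _ _ : Unit => lam) (X ^ k) (fun _ => F) =
        fun _ => ((C lam ^ k : ℂ[X]) : PowerSeries ℂ) * F := by
      induction k with
      | zero => ext i : 1; simp
      | succ k ih =>
        rw [pow_succ', map_mul, Module.End.mul_apply, ih, networkAction_X]
        ext i : 1
        simp [Matrix.mulVec, dotProduct, pow_succ', mul_assoc]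
    rw [this]
    ext i : 1
    simp [mul_assoc]

/-- The ramp starts at r instead of 0 so that its series is r / (1 - X)² with constant numerator. -/
theorem signalSeries_ramp (r : ℝ) : (((X - C 1) ^ 2 : ℂ[X]) : PowerSeries ℂ) *
    signalSeries (fun t => r * (t + 1)) = PowerSeries.C (r : ℂ) := by
  have h1 : ((1 - X : ℂ[X]) : PowerSeries ℂ) * signalSeries (fun t => r * (t + 1)) =
      PowerSeries.C (r : ℂ) * stepSeries := by
    ext t
    rw [Polynomial.coe_sub, Polynomial.coe_one, Polynomial.coe_X, sub_mul, one_mul, map_sub]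
    cases t with
    | zero => simp [coeff_signalSeries, stepSeries]
    | succ t =>
      rw [PowerSeries.coeff_succ_X_mul]
      simp [coeff_signalSeries, stepSeries]; ring
  have h2 : ((X - C 1) ^ 2 : ℂ[X]) = (1 - X) * (1 - X) := by rw [C_1]; ring
  have h3 := one_sub_X_mul_stepSeries
  rw [h2, Polynomial.coe_mul, mul_assoc, h1, mul_left_comm, h3, mul_one]

/-- Stability of `G_λ` at the eigenvalues of diagonalizable Laplacians. -/
theorem isStable_and_dvd_of_consensus {m n : ℕ} {G : AgentSystem m}
    {A : Matrix (Fin n) (Fin n) ℝ} {D N : ℂ[X][X]} {lam : ℂ} (hD : D.eval (C lam) ≠ 0)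
    (hcop : IsCoprime (D.eval (C lam)) (N.eval (C lam)))
    (hDN : ∀ (ι : Type) [Fintype ι] [DecidableEq ι] (L : Matrix ι ι ℂ) (W : ι → PowerSeries ℂ)
        (V : Fin m → ι → PowerSeries ℂ) (Y : ι → PowerSeries ℂ) (Z : Fin m → ι → PowerSeries ℂ),
        IsSeriesNetwork (G.map impulseC) L W V Y Z → networkAction L D Y = networkAction L N W)
    (hcon : ∀ (p : Fin n → Polynomial ℝ) (wstar : ℝ), (∀ i, (p i).degree < 2) →
      (∀ t : ℕ, (∑ i, (p i).eval (t : ℝ)) / n = wstar) →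
      (∃ v y z, IsNetworkTrajectory G A (fun i t => (p i).eval (t : ℝ)) v y z) ∧
      ∀ v y z, IsNetworkTrajectory G A (fun i t => (p i).eval (t : ℝ)) v y z →
        ∀ i, Tendsto (y i) atTop (𝓝 wstar))
    {c : Fin n → ℂ} (hc : Matrix.vecMul c (laplacianC A) = lam • c) {i₀ j₀ : Fin n}
    (hij : c i₀ ≠ c j₀) :
    IsStable (D.eval (C lam)) ∧ (X - C 1) ^ 2 ∣ N.eval (C lam) := by
  -- Opposite ramps at two agents where c differs: the mean is 0, so consensus forces all outputs to
  -- 0, while the combination c sees a ramp of nonzero slope c i₀ - c j₀.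
  let r : Fin n → ℝ := Pi.single i₀ 1 - Pi.single j₀ 1
  let p : Fin n → ℝ[X] := fun i => C (r i) * (X + 1)
  have hp : ∀ i (t : ℕ), (p i).eval (t : ℝ) = r i * (t + 1) := fun i t => by simp [p]
  have hsum : ∑ i, r i = 0 := by simp [r]
  obtain ⟨⟨v, y, z, htraj⟩, hlim⟩ := hcon p 0 (fun i => by
      refine lt_of_le_of_lt (b := ((1 : ℕ) : WithBot ℕ)) ?_ (by norm_cast)
      refine natDegree_le_iff_degree_le.1 ((natDegree_C_mul_le _ _).trans ?_)
      exact (natDegree_add_le _ _).trans (by simp)) (fun t => by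
      simp only [hp, ← Finset.sum_mul, hsum, zero_mul, zero_div])
  specialize hlim v y z htraj
  have hnet := htraj.isSeriesNetwork.combine (κ := Unit) (Matrix.of fun _ j => c j)
    (L' := Matrix.of fun _ _ => lam) (by
      ext _ j
      have := congrFun hc j
      simpa [Matrix.mul_apply, Matrix.vecMul, dotProduct] using this)
  have e := hDN _ _ _ _ _ _ hnet
  set F : PowerSeries ℂ := ∑ i, PowerSeries.C (c i) * signalSeries (y i) with hF
  set S : PowerSeries ℂ := ∑ i, PowerSeries.C (c i) *
    signalSeries (fun t => (p i).eval (t : ℝ)) with hSdef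
  have hY : ((Matrix.of fun (_ : Unit) j => c j).map (PowerSeries.C (R := ℂ))).mulVec
      (fun i => signalSeries (y i)) = fun _ => F := rfl
  have hW : ((Matrix.of fun (_ : Unit) j => c j).map (PowerSeries.C (R := ℂ))).mulVec
      (fun i => signalSeries fun t => (p i).eval (t : ℝ)) = fun _ => S := rfl
  rw [hY, hW, networkAction_unit, networkAction_unit] at e
  replace e := congrFun e ()
  have hκ : c i₀ - c j₀ ≠ 0 := sub_ne_zero.2 hij
  have hS : (((X - C 1) ^ 2 : ℂ[X]) : PowerSeries ℂ) * S = PowerSeries.C (c i₀ - c j₀) := by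
    have h1 : ∀ i, (((X - C 1) ^ 2 : ℂ[X]) : PowerSeries ℂ) * (PowerSeries.C (c i) *
        signalSeries (fun t => (p i).eval (t : ℝ))) = PowerSeries.C (c i * r i) := by
      intro i
      simp only [hp]
      rw [mul_left_comm, signalSeries_ramp, ← map_mul]
    rw [hSdef, Finset.mul_sum, Finset.sum_congr rfl fun i _ => h1 i, ← map_sum]
    congr 1
    have h2 : ∀ i, ((r i : ℝ) : ℂ) = (if i = i₀ then 1 else 0) - (if i = j₀ then 1 else 0) := by
      intro i
      simp only [r, Pi.sub_apply, Pi.single_apply]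
      push_cast
      simp only [apply_ite Complex.ofReal, Complex.ofReal_one, Complex.ofReal_zero]
    simp [h2, mul_sub, Finset.sum_sub_distrib]
  have hFv : Vanishing F := Vanishing.sum fun i _ => by
    refine Vanishing.C_mul ?_ _
    have := (Complex.continuous_ofReal.tendsto 0).comp (hlim i)
    rw [Complex.ofReal_zero] at this
    refine this.congr fun t => ?_
    rw [coeff_signalSeries]; rfl
  refine isStable_and_dvd_of_ramp hD hcop (F := PowerSeries.C (c i₀ - c j₀)⁻¹ * F)
    (S := PowerSeries.C (c i₀ - c j₀)⁻¹ * S) ?_ ?_ (hFv.C_mul _)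
  · rw [mul_left_comm, hS, ← map_mul, inv_mul_cancel₀ hκ, map_one]
  · rw [mul_left_comm, e, mul_left_comm]

theorem spectralRadius_lt_of_forall_norm_le {n : ℕ} {M : Matrix (Fin n) (Fin n) ℂ} {r δ : ℝ}
    (h : ∀ μ ∈ spectrum ℂ M, ‖μ‖ ≤ r) (hr : r < δ) (hδ : 0 < δ) :
    spectralRadius ℂ M < ENNReal.ofReal δ := by
  refine lt_of_le_of_lt (b := ENNReal.ofReal r) (iSup₂_le fun μ hμ => ?_)
    ((ENNReal.ofReal_lt_ofReal_iff hδ).2 hr)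
  rw [← ENNReal.ofReal_coe_nnreal, coe_nnnorm]
  exact ENNReal.ofReal_le_ofReal (h μ hμ)

theorem norm_lt_of_spectralRadius_lt {n : ℕ} {M : Matrix (Fin n) (Fin n) ℂ} {δ : ℝ}
    (h : spectralRadius ℂ M < ENNReal.ofReal δ) {μ : ℂ} (hμ : μ ∈ spectrum ℂ M) : ‖μ‖ < δ := by
  have h1 : (‖μ‖₊ : ENNReal) ≤ spectralRadius ℂ M := le_iSup₂ (α := ENNReal) μ hμ
  have h2 := h1.trans_lt h
  rw [← ENNReal.ofReal_coe_nnreal, coe_nnnorm] at h2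
  exact (ENNReal.ofReal_lt_ofReal_iff_of_nonneg (norm_nonneg μ)).1 h2

theorem exists_pos_forall_notMem {s : Set ℂ} (hs : s.Finite) :
    ∃ δ > (0 : ℝ), ∀ z : ℂ, z ≠ 0 → ‖z‖ < δ → z ∉ s := by
  have h1 : (s \ {0})ᶜ ∈ 𝓝 (0 : ℂ) :=
    (hs.subset Set.sdiff_subset).isClosed.isOpen_compl.mem_nhds (by simp)
  obtain ⟨δ, hδ, hball⟩ := Metric.mem_nhds_iff.1 h1
  refine ⟨δ, hδ, fun z hz hzδ hzs => hball (by simpa using hzδ) ⟨hzs, by simpa using hz⟩⟩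

/-- For a consensus estimator of order two, `G_λ = (X - 1)² N(λ) / D(λ)` with `D(λ)` stable for
small `λ` in a sector. -/
theorem exists_transfer_of_consensus {m : ℕ} {G : AgentSystem m}
    (hstrict : ∀ i j, IsStrictlyProper (G.toBlocks₂₂ i j)) (hcon : IsConsensusEstimator 2 G) :
    ∃ D N : ℂ[X][X],
      (∀ K > (0 : ℝ), ∃ δ > (0 : ℝ), ∀ lam : ℂ, 0 < lam.re → |lam.im| ≤ K * lam.re → ‖lam‖ < δ →
        IsStable (D.eval (C lam))) ∧
      ∀ (ι : Type) [Fintype ι] [DecidableEq ι] (L : Matrix ι ι ℂ) (W : ι → PowerSeries ℂ)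
        (V : Fin m → ι → PowerSeries ℂ) (Y : ι → PowerSeries ℂ) (Z : Fin m → ι → PowerSeries ℂ),
        IsSeriesNetwork (G.map impulseC) L W V Y Z →
          networkAction L D Y = networkAction L (C ((X - C 1) ^ 2) * N) W := by
  obtain ⟨D, N, hD, hrel, hDN⟩ := exists_transfer (G := G.map impulseC)
    (fun s s' => exists_mul_impulseC_eq _)
    (fun k l => constantCoeff_impulseC (hstrict k l))
  have hDfin : {lam : ℂ | D.eval (C lam) = 0}.Finite := by
    have h1 : (D.roots.toFinset : Set ℂ[X]).Finite := D.roots.toFinset.finite_toSet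
    refine (h1.preimage (f := fun lam : ℂ => (C lam : ℂ[X])) C_injective.injOn).subset ?_
    intro lam hlam
    simpa [hD] using hlam
  -- Near 0, and away from 0 itself, no λ spoils coprimality or annihilates D, so the reduced
  -- bivariate fraction stays reduced at λ.
  obtain ⟨δ₀, hδ₀, hexc⟩ := exists_pos_forall_notMem
    ((finite_not_isCoprime_eval hD hrel).union hDfin)
  have main : ∀ K > (0 : ℝ), ∃ δ > (0 : ℝ), ∀ lam : ℂ, 0 < lam.re → |lam.im| ≤ K * lam.re →
      ‖lam‖ < δ → IsStable (D.eval (C lam)) ∧ (X - C 1) ^ 2 ∣ N.eval (C lam) := by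
    intro K hK
    obtain ⟨n, R, hR, hlap⟩ := exists_diagonalizable_laplacian K hK
    -- The network is the complete one on n agents, with n depending only on the sector; so one
    -- threshold δ₁ serves all λ.
    obtain ⟨δ₁, hδ₁, hcon'⟩ := hcon n ⊤ fun i j => Relation.ReflTransGen.single (by simp)
    refine ⟨min δ₀ (δ₁ / R), lt_min hδ₀ (div_pos hδ₁ hR), fun lam hre him hlam => ?_⟩
    obtain ⟨A, hA, hdiag, hspec, c, hc, i, j, hij⟩ := hlap lam hre him
    have hlam0 : lam ≠ 0 := by rintro rfl; simp at hre
    have hnot := hexc lam hlam0 (hlam.trans_le (min_le_left _ _))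
    simp only [Set.mem_union, Set.mem_ofPred_eq, not_or, not_not] at hnot
    refine isStable_and_dvd_of_consensus hnot.2 hnot.1 hDN (hcon' A hA ?_ hdiag) hc hij
    refine spectralRadius_lt_of_forall_norm_le hspec ?_ hδ₁
    have h1 : lam.re < δ₁ / R := ((Complex.re_le_norm lam).trans_lt hlam).trans_le (min_le_right _ _)
    rwa [lt_div_iff₀ hR, mul_comm] at h1
  obtain ⟨N', rfl⟩ : C ((X - C 1) ^ 2) ∣ N := by
    obtain ⟨δ, hδ, h⟩ := main 1 one_pos
    refine C_X_sub_one_sq_dvd (s := Complex.ofReal '' Set.Ioo 0 δ)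
      ((Set.Ioo_infinite hδ).image Complex.ofReal_injective.injOn) ?_
    rintro _ ⟨x, hx, rfl⟩
    refine (h x (by simpa using hx.1) ?_ ?_).2
    · simpa using hx.1.le
    · rw [Complex.norm_of_nonneg hx.1.le]; exact hx.2
  refine ⟨D, N', fun K hK => ?_, hDN⟩
  obtain ⟨δ, hδ, h⟩ := main K hK
  exact ⟨δ, hδ, fun lam h1 h2 h3 => (h lam h1 h2 h3).1⟩

theorem signalSeries_one : signalSeries (fun _ => 1) = stepSeries := by
  ext t
  simp [coeff_signalSeries, stepSeries]

theorem vanishing_signalSeries_sub {y : ℕ → ℝ} {c : ℝ} (h : Tendsto y atTop (𝓝 c)) :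
    Vanishing (signalSeries y - PowerSeries.C (c : ℂ) * stepSeries) := by
  have := (Complex.continuous_ofReal.tendsto 0).comp (tendsto_sub_nhds_zero_iff.2 h)
  rw [Complex.ofReal_zero] at this
  refine this.congr fun t => ?_
  simp [coeff_signalSeries, stepSeries]

/-- `G¹¹` is stable with unit static gain. -/
theorem exists_output_eq_of_consensus {m : ℕ} {G : AgentSystem m} {l : ℕ} (hl : 0 < l)
    (hcon : IsConsensusEstimator l G) : ∃ a b : ℂ[X], IsStable b ∧ a.eval 1 = b.eval 1 ∧
      (b : PowerSeries ℂ) * impulseC (G (Sum.inl ()) (Sum.inl ())) = a := by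
  -- A single agent without edges has Laplacian 0 and receives v = 0, so the constant input 1 tests
  -- G¹¹ alone.
  obtain ⟨δ, hδ, h⟩ := hcon 1 ⊥ fun i j => by rw [Subsingleton.elim i j]
  have hlap : laplacianC (0 : Matrix (Fin 1) (Fin 1) ℝ) = 0 := by
    ext i j; simp [laplacianC, laplacian]
  obtain ⟨⟨v, y, z, htraj⟩, hlim⟩ := h 0
    ⟨fun i j => le_rfl, fun i j => by simp, fun j => by simp [laplacian]⟩
    (spectralRadius_lt_of_forall_norm_le (r := 0) (fun μ hμ => by
      obtain ⟨w, hw0, hw⟩ := mem_spectrum_iff_exists_mulVec.1 hμ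
      rw [hlap, Matrix.zero_mulVec, eq_comm, smul_eq_zero] at hw
      rw [hw.resolve_right hw0, norm_zero]) hδ hδ)
    ⟨1, 0, isUnit_one, by rw [hlap]; simp⟩ (fun _ => 1) 1
    (fun _ => by rw [degree_one]; exact_mod_cast hl) (fun t => by simp)
  have hvan := vanishing_signalSeries_sub (hlim v y z htraj 0)
  have hnet := htraj.isSeriesNetwork
  have hY := congrFun hnet.output 0
  have hV : ∀ k, (fun i => signalSeries (v i k)) = 0 := fun k => by
    rw [hnet.network k, hlap]; simp
  simp only [hV, smul_zero, Finset.sum_const_zero, add_zero, eval_one, signalSeries_one] at hY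
  set g := impulseC (G (Sum.inl ()) (Sum.inl ())) with hg
  replace hY : signalSeries (y 0) = g * stepSeries := hY
  rw [hY, Complex.ofReal_one, map_one, one_mul] at hvan
  obtain ⟨P, Q, hQ0, hPQ⟩ := exists_mul_impulseC_eq (G (Sum.inl ()) (Sum.inl ()))
  rw [← hg] at hPQ
  have hQ : Q ≠ 0 := by rintro rfl; simp at hQ0
  have hstep := one_sub_X_mul_stepSeries
  have hX : (1 - X : ℂ[X]) ≠ 0 := by
    intro h0
    have := congrArg (Polynomial.eval 0) h0
    simp at this
  -- The tracking error (G¹¹ - 1) / (1 - X) vanishes, so it is P' / Q' with Q' stable. Then G¹¹ = 1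
  -- + (1 - X) P' / Q' has denominator Q' and value 1 at X = 1.
  obtain ⟨P', Q', -, hst, -, -, hE⟩ := exists_isStable_of_vanishing (P := P - Q)
    (mul_ne_zero hX hQ) (F := g * stepSeries - stepSeries) (by
      rw [Polynomial.coe_mul, Polynomial.coe_sub P]
      linear_combination (Q : PowerSeries ℂ) * (g - 1) * hstep + hPQ) hvan
  refine ⟨Q' + (1 - X) * P', Q', hst, by simp, ?_⟩
  rw [Polynomial.coe_add, Polynomial.coe_mul, ← hE]
  linear_combination (-(Q' : PowerSeries ℂ) * (g - 1)) * hstep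

/-! ### The pole and the residue of an optimization method -/

theorem deriv_quadratic (ε ystar x : ℝ) : deriv (quadratic ε ystar) x = ε * (x - ystar) := by
  have h : HasDerivAt (quadratic ε ystar) (ε / 2 * (2 * (x - ystar))) x := by
    have := (((hasDerivAt_id x).sub_const ystar).pow 2).const_mul (ε / 2)
    refine HasDerivAt.congr_deriv (f' := ε / 2 * ((2 : ℕ) * (x - ystar) ^ (2 - 1) * 1)) this ?_
    simp
  rw [h.deriv]; ring

/-- A real polynomial without zeros in the unit disk has no sign change between `0` and `1`. -/
theorem mul_pos_of_isStable {f : ℝ[X]} (h : IsStable (f.map Complex.ofRealHom)) :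
    0 < f.eval 0 * f.eval 1 := by
  have hne : ∀ x ∈ Set.uIcc (0 : ℝ) 1, f.eval x ≠ 0 := by
    intro x hx h0
    rw [Set.uIcc_of_le zero_le_one] at hx
    refine h x (by rw [Complex.norm_of_nonneg hx.1]; exact hx.2) ?_
    have := Polynomial.eval_map_apply (p := f) Complex.ofRealHom x
    rw [h0, map_zero] at this
    exact this
  by_contra hle
  have hmem : (0 : ℝ) ∈ Set.uIcc (f.eval 0) (f.eval 1) := by
    rw [Set.mem_uIcc]
    by_contra hcon
    push Not at hcon
    rcases le_or_gt (f.eval 0) 0 with h0 | h0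
    · nlinarith [hcon.1 h0, hne 0 (by simp), h0.lt_of_ne (hne 0 (by simp))]
    · rcases le_or_gt (f.eval 1) 0 with h1 | h1
      · nlinarith [hcon.2 h1]
      · nlinarith
  obtain ⟨x, hx, hx0⟩ := intermediate_value_uIcc f.continuous.continuousOn hmem
  exact hne x hx hx0

/-- An optimization method has a simple pole at `1` with negative residue and is otherwise
stable. -/
theorem exists_response_eq_of_optimizationMethod {G : RatFunc ℝ}
    (hopt : IsOptimizationMethod G) : ∃ p q : ℝ[X], IsStable (q.map Complex.ofRealHom) ∧
      p.eval 1 * q.eval 1 < 0 ∧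
      ((q.map Complex.ofRealHom : ℂ[X]) : PowerSeries ℂ) *
        (((1 - X : ℂ[X]) : PowerSeries ℂ) * impulseC G) = (p.map Complex.ofRealHom : ℂ[X]) := by
  -- Idling under a unit impulse returns the impulse response itself, which therefore converges; its
  -- only possible unstable pole is a simple one at 1. The fraction is reduced over ℝ because the
  -- sign of the residue is decided by the intermediate value theorem.
  obtain ⟨c, hc⟩ := hopt.idle 0 (Finsupp.single 0 1) _ _
    ⟨rfl, fun t => by rw [deriv_quadratic, zero_mul, zero_add]⟩
  have hone : signalSeries (fun t => (Finsupp.single 0 1 : ℕ →₀ ℝ) t) = 1 := by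
    ext t
    rw [coeff_signalSeries, PowerSeries.coeff_one, Finsupp.single_apply]
    rcases eq_or_ne t 0 with rfl | h
    · simp
    · simp [h, h.symm]
  have hvan : Vanishing (((1 - X : ℂ[X]) : PowerSeries ℂ) * impulseC G) := by
    have h1 := vanishing_signalSeries_sub hc
    rw [signalSeries_response, hone, mul_one] at h1
    have h2 := (h1.coe_mul (1 - X)).add (isSummable_coe (C (c : ℂ))).vanishing
    have h3 : ((1 - X : ℂ[X]) : PowerSeries ℂ) * impulseC G = ((1 - X : ℂ[X]) : PowerSeries ℂ) *
        (impulseC G - PowerSeries.C (c : ℂ) * stepSeries) + (C (c : ℂ) : ℂ[X]) := by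
      rw [Polynomial.coe_C]
      linear_combination PowerSeries.C (c : ℂ) * one_sub_X_mul_stepSeries
    rw [h3]
    exact h2
  obtain ⟨P, Q, hQ0, hPQ⟩ := exists_mul_impulseResponse_eq G
  have hQ : Q ≠ 0 := by rintro rfl; simp at hQ0
  obtain ⟨q, p, g, hrel, hgq, hgp⟩ :=
    UniqueFactorizationMonoid.exists_reduced_factors Q hQ ((1 - X) * P)
  have hg : (g : PowerSeries ℝ) ≠ 0 := by
    rw [Ne, Polynomial.coe_eq_zero_iff]
    rintro rfl
    exact hQ (by rw [← hgq, zero_mul])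
  have hreal : (q : PowerSeries ℝ) * (((1 - X : ℝ[X]) : PowerSeries ℝ) * impulseResponse G) =
      p := by
    refine mul_left_cancel₀ hg ?_
    rw [← mul_assoc, ← Polynomial.coe_mul, ← Polynomial.coe_mul, hgq, hgp, Polynomial.coe_mul,
      ← hPQ]
    ring
  have hcop : IsCoprime (p.map Complex.ofRealHom) (q.map Complex.ofRealHom) :=
    (Polynomial.isCoprime_map _).2 hrel.isCoprime.symm
  have hpq : ((q.map Complex.ofRealHom : ℂ[X]) : PowerSeries ℂ) *
      (((1 - X : ℂ[X]) : PowerSeries ℂ) * impulseC G) = (p.map Complex.ofRealHom : ℂ[X]) := by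
    have := congrArg (PowerSeries.map Complex.ofRealHom) hreal
    rw [map_mul, map_mul, ← Polynomial.polynomial_map_coe, ← Polynomial.polynomial_map_coe,
      ← Polynomial.polynomial_map_coe] at this
    simpa [impulseC] using this
  have hqst : IsStable (q.map Complex.ofRealHom) := isStable_of_vanishing hcop hpq hvan
  refine ⟨p, q, hqst, ?_, hpq⟩
  have hq01 := mul_pos_of_isStable hqst
  have hq0 : 0 < |q.eval 0| := abs_pos.2 fun h0 => by rw [h0, zero_mul] at hq01; exact hq01.false
  obtain ⟨ε₀, hε₀, hε⟩ := hopt.optimizes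
  -- The second bound keeps r(0) = q(0) - ε p(0) of the same sign as q(0).
  obtain ⟨ε, hε1, hε2⟩ : ∃ ε, 0 < ε ∧ ε < min ε₀ (|q.eval 0| / (|p.eval 0| + 1)) :=
    exists_between (lt_min hε₀ (by positivity))
  obtain ⟨⟨u, y, htraj⟩, hlim⟩ := hε ε hε1 (hε2.trans_le (min_le_left _ _)) 1 0
  have hE := vanishing_signalSeries_sub (hlim u y htraj)
  rw [Complex.ofReal_one, map_one, one_mul] at hE
  have hY : signalSeries y = impulseC G * signalSeries u := by
    rw [htraj.system, signalSeries_response]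
  have hU : signalSeries u = PowerSeries.C (ε : ℂ) * (signalSeries y - stepSeries) := by
    ext t
    rw [PowerSeries.coeff_C_mul, coeff_signalSeries, htraj.feedback, deriv_quadratic]
    simp [coeff_signalSeries, stepSeries]
  -- The characteristic polynomial of the loop: the error y - 1 has series -q / r in lowest terms,
  -- so r is stable.
  let r : ℝ[X] := (1 - X) * q - C ε * p
  have hrmap : r.map Complex.ofRealHom = (1 - X) * q.map Complex.ofRealHom -
      C (ε : ℂ) * p.map Complex.ofRealHom := by
    simp [r]
  have hrst : IsStable (r.map Complex.ofRealHom) := by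
    refine isStable_of_vanishing (P := -q.map Complex.ofRealHom) ?_ ?_ hE
    · rw [hrmap]
      refine IsCoprime.neg_left ?_
      have h1 : IsCoprime (q.map Complex.ofRealHom) (-(C (ε : ℂ) * p.map Complex.ofRealHom)) := by
        refine IsCoprime.neg_right (IsCoprime.mul_right ?_ hcop.symm)
        exact (isCoprime_one_right (x := q.map Complex.ofRealHom)).of_isCoprime_of_dvd_right
          (isUnit_C.2 (by simpa using hε1.ne')).dvd
      have := h1.mul_add_right_right (1 - X)
      rwa [← sub_eq_add_neg, ] at this
    · rw [hrmap]
      simp only [Polynomial.coe_sub, Polynomial.coe_mul, Polynomial.coe_C, Polynomial.coe_neg,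
        Polynomial.coe_one, Polynomial.coe_X] at hpq ⊢
      have hstep := one_sub_X_mul_stepSeries
      simp only [Polynomial.coe_sub, Polynomial.coe_one, Polynomial.coe_X] at hstep
      linear_combination signalSeries u * hpq +
        (1 - PowerSeries.X) * ((q.map Complex.ofRealHom : ℂ[X]) : PowerSeries ℂ) * hY -
        ((q.map Complex.ofRealHom : ℂ[X]) : PowerSeries ℂ) * hstep +
        ((p.map Complex.ofRealHom : ℂ[X]) : PowerSeries ℂ) * hU
  have hr01 := mul_pos_of_isStable hrst
  have hr0 : r.eval 0 = q.eval 0 - ε * p.eval 0 := by simp [r]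
  have hr1 : r.eval 1 = -(ε * p.eval 1) := by simp [r]
  have hrq : 0 < r.eval 0 * q.eval 0 := by
    have h1 : ε * (|p.eval 0| + 1) < |q.eval 0| := by
      have := hε2.trans_le (min_le_right _ _)
      rwa [lt_div_iff₀ (by positivity)] at this
    have h2 : |ε * p.eval 0| < |q.eval 0| := by
      rw [abs_mul, abs_of_pos hε1]; nlinarith
    rw [hr0]
    have h3 : ε * p.eval 0 * q.eval 0 < q.eval 0 * q.eval 0 := by
      refine (le_abs_self _).trans_lt ?_
      rw [abs_mul, ← abs_mul_abs_self (q.eval 0)]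
      exact mul_lt_mul_of_pos_right h2 hq0
    linarith
  -- Stable real polynomials keep their sign on [0, 1], so r(1), r(0), q(0) and q(1) all have the
  -- same sign, and r(1) = -ε p(1).
  have hprod : 0 < (r.eval 0 * r.eval 1) * (r.eval 0 * q.eval 0) * (q.eval 0 * q.eval 1) := by
    positivity
  have hfin : 0 < (r.eval 0 * q.eval 0) ^ 2 * (r.eval 1 * q.eval 1) := by
    calc _ < _ := hprod
      _ = _ := by ring
  have := (mul_pos_iff_of_pos_left (pow_pos hrq 2)).1 hfin
  rw [hr1] at this
  nlinarith

end

/-! ### The combined system -/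

theorem combine_inl {m : ℕ} (Gcon : AgentSystem m) (Gopt : RatFunc ℝ) (s : Unit ⊕ Fin m) :
    combine Gcon Gopt s (Sum.inl ()) = Gcon s (Sum.inl ()) * Gopt := by
  simp [combine, Matrix.mul_apply]

theorem combine_inr {m : ℕ} (Gcon : AgentSystem m) (Gopt : RatFunc ℝ) (s : Unit ⊕ Fin m)
    (k : Fin m) : combine Gcon Gopt s (Sum.inr k) = Gcon s (Sum.inr k) := by
  simp [combine, Matrix.mul_apply, Matrix.one_apply]

theorem isProper_combine {m : ℕ} {Gcon : AgentSystem m} {Gopt : RatFunc ℝ}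
    (hopt : IsProper Gopt) (hcon : ∀ i j, IsProper (Gcon i j)) (i j) :
    IsProper (combine Gcon Gopt i j) := by
  rcases j with ⟨⟩ | k
  · rw [combine_inl]; exact (hcon _ _).mul hopt
  · rw [combine_inr]; exact hcon _ _

theorem isStrictlyProper_combine_mul {m : ℕ} {Gcon : AgentSystem m} {Gopt : RatFunc ℝ}
    (hopt : IsProper Gopt) (hcon : ∀ i j, IsProper (Gcon i j))
    (hstrict : IsStrictlyProper Gopt ∨
      ∀ i j, IsStrictlyProper ((Gcon.toBlocks₂₁ * Gcon.toBlocks₁₂) i j)) (i j) :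
    IsStrictlyProper (((combine Gcon Gopt).toBlocks₂₁ * (combine Gcon Gopt).toBlocks₁₂) i j) := by
  have e : ((combine Gcon Gopt).toBlocks₂₁ * (combine Gcon Gopt).toBlocks₁₂) i j =
      Gcon (Sum.inr i) (Sum.inl ()) * Gcon (Sum.inl ()) (Sum.inr j) * Gopt := by
    simp only [Matrix.mul_apply, Matrix.toBlocks₂₁, Matrix.toBlocks₁₂, Matrix.of_apply,
      Finset.univ_unique, Finset.sum_singleton, PUnit.default_eq_unit, combine_inl, combine_inr]
    ring
  rw [e]
  rcases hstrict with h | h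
  · rw [mul_comm]
    exact h.mul_isProper ((hcon _ _).mul (hcon _ _))
  · refine IsStrictlyProper.mul_isProper ?_ hopt
    simpa [Matrix.mul_apply, Matrix.toBlocks₂₁, Matrix.toBlocks₁₂] using h i j

/-! ### Well-posedness of the feedback loop -/

theorem sum_laplacian_row {n : ℕ} (A : Matrix (Fin n) (Fin n) ℝ) (i : Fin n) :
    ∑ j, laplacian A i j = 0 := by
  simp [laplacian, Matrix.diagonal_apply]

theorem sum_mul_sub_eq_laplacian {n : ℕ} (A : Matrix (Fin n) (Fin n) ℝ) (x : Fin n → ℝ)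
    (i : Fin n) : ∑ j, A i j * (x i - x j) = ∑ j, laplacian A i j * x j := by
  simp [laplacian, mul_sub, sub_mul, Matrix.diagonal_apply, Finset.sum_mul]

/-- The loop matrix of `n` agents in feedback with the network and with static gain `ε`. -/
def closedLoop {R : Type*} [CommRing R] {m n : ℕ}
    (h : Matrix (Unit ⊕ Fin m) (Unit ⊕ Fin m) R) (L : Matrix (Fin n) (Fin n) R) (ε : R) :
    Matrix (Fin n × (Unit ⊕ Fin m)) (Fin n × (Unit ⊕ Fin m)) R :=
  Matrix.of fun a b => h a.2 b.2 *
    Sum.elim (fun _ => if a.1 = b.1 then ε else 0) (fun _ => L a.1 b.1) b.2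

theorem closedLoop_mulVec {R : Type*} [CommRing R] {m n : ℕ}
    (h : Matrix (Unit ⊕ Fin m) (Unit ⊕ Fin m) R) (L : Matrix (Fin n) (Fin n) R) (ε : R)
    (x : Fin n × (Unit ⊕ Fin m) → R) (i : Fin n) (s : Unit ⊕ Fin m) :
    (closedLoop h L ε).mulVec x (i, s) = h s (Sum.inl ()) * (ε * x (i, Sum.inl ())) +
      ∑ k, h s (Sum.inr k) * ∑ j, L i j * x (j, Sum.inr k) := by
  simp only [Matrix.mulVec, dotProduct, closedLoop, Matrix.of_apply]
  rw [Fintype.sum_prod_type_right, Fintype.sum_sum_type]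
  simp [Finset.mul_sum, mul_assoc]

/-- At ε = 0 a vector in the kernel has no messages, because the instantaneous gain h²² is 0, and
then no outputs. Continuity of the determinant extends this to small ε. -/
theorem det_one_sub_closedLoop_ne_zero {m n : ℕ}
    {h : Matrix (Unit ⊕ Fin m) (Unit ⊕ Fin m) ℝ} (L : Matrix (Fin n) (Fin n) ℝ)
    (h0 : ∀ k l, h (Sum.inr k) (Sum.inr l) = 0) :
    ∃ ε₀ > (0 : ℝ), ∀ ε, |ε| < ε₀ → (1 - closedLoop h L ε).det ≠ 0 := by
  have hcont : Continuous fun ε : ℝ => (1 - closedLoop h L ε).det := by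
    refine Continuous.matrix_det (continuous_const.sub (continuous_matrix fun a b => ?_))
    rcases b with ⟨j, ⟨⟩ | k⟩
    · simp only [closedLoop, Matrix.of_apply, Sum.elim_inl]
      split_ifs <;> fun_prop
    · simp only [closedLoop, Matrix.of_apply, Sum.elim_inr]
      fun_prop
  have hne : (1 - closedLoop h L 0).det ≠ 0 := by
    intro hdet
    obtain ⟨x, hx0, hx⟩ := Matrix.exists_mulVec_eq_zero_iff.2 hdet
    apply hx0
    rw [Matrix.sub_mulVec, Matrix.one_mulVec, sub_eq_zero] at hx
    have h1 : ∀ i k, x (i, Sum.inr k) = 0 := fun i k => by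
      rw [congrFun hx (i, Sum.inr k), closedLoop_mulVec]
      simp [h0]
    ext ⟨i, s⟩
    rw [congrFun hx (i, s), closedLoop_mulVec]
    simp [h1]
  obtain ⟨ε₀, hε₀, hball⟩ := Metric.mem_nhds_iff.1 (hcont.continuousAt.eventually_ne hne)
  exact ⟨ε₀, hε₀, fun ε hε => hball (by simpa using hε)⟩

/-- Well-posedness of the closed loop for small gains. -/
theorem exists_networkTrajectory_feedback {m n : ℕ} {H : AgentSystem m}
    (hstrict : ∀ i j, IsStrictlyProper (H.toBlocks₂₂ i j)) (A : Matrix (Fin n) (Fin n) ℝ) :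
    ∃ ε₀ > (0 : ℝ), ∀ ε, |ε| < ε₀ → ∀ c : Fin n → ℕ → ℝ, ∃ u v y z,
      IsNetworkTrajectory H A u v y z ∧ ∀ i t, u i t = ε * y i t + c i t := by
  let h : Matrix (Unit ⊕ Fin m) (Unit ⊕ Fin m) (PowerSeries ℝ) := H.map impulseResponse
  obtain ⟨ε₀, hε₀, hdet⟩ := det_one_sub_closedLoop_ne_zero
    (h := h.map (PowerSeries.constantCoeff (R := ℝ))) (laplacian A)
    (fun k l => constantCoeff_impulseResponse (hstrict k l))
  refine ⟨ε₀, hε₀, fun ε hε c => ?_⟩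
  let F := closedLoop h ((laplacian A).map (PowerSeries.C (R := ℝ))) (PowerSeries.C ε)
  -- Only the instantaneous gains matter: a matrix of power series is invertible when its constant
  -- term is.
  have hF : IsUnit (1 - F).det := by
    rw [PowerSeries.isUnit_iff_constantCoeff, RingHom.map_det, isUnit_iff_ne_zero]
    convert hdet ε hε using 2
    rw [map_sub, map_one]
    congr 1
    ext a ⟨j, ⟨⟩ | k⟩
    · simp only [F, closedLoop, RingHom.mapMatrix_apply, Matrix.map_apply, Matrix.of_apply,
        Sum.elim_inl, map_mul]
      split_ifs <;> simp
    · simp [F, closedLoop]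
  let b : Fin n × (Unit ⊕ Fin m) → PowerSeries ℝ := fun a =>
    h a.2 (Sum.inl ()) * PowerSeries.mk (c a.1)
  let x := (1 - F)⁻¹.mulVec b
  have hx : x = F.mulVec x + b := by
    have : (1 - F).mulVec x = b := by
      rw [Matrix.mulVec_mulVec, Matrix.mul_nonsing_inv _ hF, Matrix.one_mulVec]
    rw [← this, Matrix.sub_mulVec, Matrix.one_mulVec]
    abel
  let y : Fin n → ℕ → ℝ := fun i t => PowerSeries.coeff t (x (i, Sum.inl ()))
  let z : Fin n → Fin m → ℕ → ℝ := fun i k t => PowerSeries.coeff t (x (i, Sum.inr k))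
  let u : Fin n → ℕ → ℝ := fun i t => ε * y i t + c i t
  let v : Fin n → Fin m → ℕ → ℝ := fun i k t => ∑ j, A i j * (z i k t - z j k t)
  have hu : ∀ i, PowerSeries.mk (u i) =
      PowerSeries.C ε * x (i, Sum.inl ()) + PowerSeries.mk (c i) := fun i => by
    ext t; simp [u, y]
  have hv : ∀ i k, PowerSeries.mk (v i k) =
      ∑ j, (laplacian A).map (PowerSeries.C (R := ℝ)) i j * x (j, Sum.inr k) := fun i k => by
    ext t
    simp only [v, PowerSeries.coeff_mk, map_sum, Matrix.map_apply, PowerSeries.coeff_C_mul]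
    exact sum_mul_sub_eq_laplacian A (fun j => z j k t) i
  refine ⟨u, v, y, z, ⟨fun i => ?_, fun i k t => rfl⟩, fun i t => rfl⟩
  funext s
  have h1 : PowerSeries.mk (matrixResponse H (Sum.elim (fun _ => u i) (v i)) s) = x (i, s) := by
    have h2 : PowerSeries.mk (matrixResponse H (Sum.elim (fun _ => u i) (v i)) s) =
        ∑ s', PowerSeries.mk (response (H s s') (Sum.elim (fun _ => u i) (v i) s')) := by
      ext t
      simp only [matrixResponse, PowerSeries.coeff_mk, map_sum]
    rw [h2, congrFun hx (i, s), Pi.add_apply, closedLoop_mulVec, Fintype.sum_sum_type]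
    simp only [mk_response, Finset.univ_unique, Finset.sum_singleton, Sum.elim_inl, Sum.elim_inr,
      hu, hv, PUnit.default_eq_unit, b, h, Matrix.map_apply]
    ring
  funext t
  have h3 := congrArg (PowerSeries.coeff t) h1
  rw [PowerSeries.coeff_mk] at h3
  rw [h3]
  rcases s with ⟨⟩ | k <;> rfl

section

open Polynomial

/-! ### Convergence of the combined system -/

/-- The pole of the average dynamics at `1` moves into the stability region. -/
theorem exists_isStable_sub {a b p q : ℂ[X]} (hb : IsStable b) (hq : IsStable q)
    (hab : a.eval 1 = b.eval 1) (hpq : (p.eval 1 / q.eval 1).re < 0) :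
    ∃ ε₀ > (0 : ℝ), ∀ ε, 0 < ε → ε < ε₀ →
      IsStable ((1 - X) * (b * q) - C (ε : ℂ) * (a * p)) := by
  -- A root in the disk satisfies 1 - x = ε h(x). As h is bounded there, x is close to 1, where Re h
  -- < 0; so Re x > 1, a contradiction.
  let h : ℂ → ℂ := fun x => (a * p).eval x / (b * q).eval x
  have hden : ∀ x, ‖x‖ ≤ 1 → (b * q).eval x ≠ 0 := hb.mul hq
  have hcont : ContinuousOn h (Metric.closedBall 0 1) := by
    refine ContinuousOn.div (a * p).continuous.continuousOn (b * q).continuous.continuousOn ?_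
    intro x hx
    exact hden x (by simpa using hx)
  have h1 : (h 1).re < 0 := by
    have hb1 : b.eval 1 ≠ 0 := hb 1 (by simp)
    simp only [h, eval_mul, hab]
    rwa [mul_div_mul_left _ _ hb1]
  obtain ⟨M, hM⟩ := (isCompact_closedBall (0 : ℂ) 1).exists_bound_of_continuousOn hcont
  have hev : ∀ᶠ x in 𝓝[Metric.closedBall 0 1] (1 : ℂ), (h x).re < 0 :=
    (Complex.continuous_re.continuousAt.comp_continuousWithinAt
      (hcont 1 (by simp))).eventually_lt continuousWithinAt_const h1
  obtain ⟨η, hη, hball⟩ := Metric.mem_nhdsWithin_iff.1 hev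
  refine ⟨η / (|M| + 1), by positivity, fun ε hε hε₀ x hx h0 => ?_⟩
  rw [lt_div_iff₀ (by positivity)] at hε₀
  have hx' : x ∈ Metric.closedBall (0 : ℂ) 1 := by simpa using hx
  have heq : 1 - x = ε * h x := by
    have hd := hden x hx
    simp only [eval_sub, eval_mul, eval_one, eval_X, eval_C] at h0 hd
    simp only [h, eval_mul]
    rw [mul_div_assoc', eq_div_iff hd]
    linear_combination h0
  have hdist : ‖x - 1‖ < η := by
    rw [norm_sub_rev, heq, norm_mul, Complex.norm_of_nonneg hε.le]
    have := (hM x hx').trans (le_abs_self M)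
    nlinarith
  have hre : (h x).re < 0 := hball ⟨by simpa [dist_eq_norm] using hdist, hx'⟩
  have h2 := congrArg Complex.re heq
  rw [Complex.sub_re, Complex.one_re, Complex.re_ofReal_mul] at h2
  nlinarith [(Complex.re_le_norm x).trans hx]

theorem eval_det {ι : Type*} [Fintype ι] [DecidableEq ι] (M : Matrix ι ι ℂ[X]) (x : ℂ) :
    M.det.eval x = (M.map (Polynomial.eval x)).det := by
  have := RingHom.map_det (evalRingHom x) M
  simpa using this

/-- Stability of the determinant of a polynomial matrix persists under small perturbations. -/
theorem exists_isStable_det_sub {ι : Type*} [Fintype ι] [DecidableEq ι] (M₀ M₁ : Matrix ι ι ℂ[X])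
    (h₀ : IsStable M₀.det) :
    ∃ ε₀ > (0 : ℝ), ∀ ε : ℝ, |ε| < ε₀ → IsStable (M₀ - C (ε : ℂ) • M₁).det := by
  have hcont : Continuous fun z : ℝ × ℂ => (M₀ - C (z.1 : ℂ) • M₁).det.eval z.2 := by
    simp only [eval_det]
    refine Continuous.matrix_det (continuous_matrix fun i j => ?_)
    simp only [Matrix.map_apply, Matrix.sub_apply, Matrix.smul_apply, smul_eq_mul, eval_sub,
      eval_mul, eval_C]
    have := (M₀ i j).continuous
    have := (M₁ i j).continuous
    fun_prop
  -- The determinant is jointly continuous in ε and x and nonzero on {0} × disk; compactness of the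
  -- disk gives one neighbourhood of ε = 0 for all x.
  have hev : ∀ᶠ ε : ℝ in 𝓝 (0 : ℝ), ∀ x ∈ Metric.closedBall (0 : ℂ) 1,
      (M₀ - C (ε : ℂ) • M₁).det.eval x ≠ 0 := by
    refine (isCompact_closedBall (0 : ℂ) 1).eventually_forall_of_forall_eventually
      (P := fun (ε : ℝ) x => (M₀ - C (ε : ℂ) • M₁).det.eval x ≠ 0) fun x hx => ?_
    refine hcont.continuousAt.eventually_ne ?_
    simpa using h₀ x (by simpa using hx)
  obtain ⟨ε₀, hε₀, hball⟩ := Metric.mem_nhds_iff.1 hev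
  exact ⟨ε₀, hε₀, fun ε hε x hx => hball (by simpa using hε) x (by simpa using hx)⟩

/-- The determinant of `D(L)` is stable if all `D(λ)` are. -/
theorem isStable_det_aeval {ι : Type} [Fintype ι] [DecidableEq ι] {L : Matrix ι ι ℂ}
    {D : ℂ[X][X]} (h : ∀ μ ∈ spectrum ℂ L, IsStable (D.eval (C μ))) :
    IsStable (aeval (L.map (C : ℂ → ℂ[X])) D).det := by
  intro x hx h0
  cases isEmpty_or_nonempty ι with
  | inl hι => simp at h0
  | inr hι =>
    have h1 : (aeval (L.map (C : ℂ → ℂ[X])) D).map (Polynomial.eval x) =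
        aeval L (D.map (evalRingHom x)) := by
      have := map_aeval_matrix (evalRingHom x) (evalRingHom x) (by ext <;> simp)
        (L.map (C : ℂ → ℂ[X])) D
      have hL : (L.map (C : ℂ → ℂ[X])).map (evalRingHom x) = L := by ext i j; simp
      rw [hL] at this
      exact this
    rw [eval_det, h1] at h0
    -- With X fixed at x, D becomes an ordinary polynomial in λ, and spectral mapping finds an
    -- eigenvalue μ of L with D(μ)(x) = 0. This needs no diagonalizability of L.
    have h2 : (0 : ℂ) ∈ spectrum ℂ (aeval L (D.map (evalRingHom x))) := by
      rw [spectrum.zero_mem_iff, Matrix.isUnit_iff_isUnit_det, isUnit_iff_ne_zero, not_not]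
      exact h0
    rw [spectrum.map_polynomial_aeval_of_nonempty _ _
      (spectrum.nonempty_of_isAlgClosed_of_finiteDimensional ℂ L)] at h2
    obtain ⟨μ, hμ, hμ0⟩ := h2
    refine h μ hμ x hx ?_
    have e := Polynomial.eval₂_at_apply (p := D) (evalRingHom x) (C μ)
    simp only [coe_evalRingHom, eval_C] at e
    rw [← e, ← Polynomial.eval_map]
    exact hμ0

/-- The coefficients of p are polynomials in X, so p(L) is a polynomial matrix; its determinant is a
polynomial to which `IsStable` applies. -/
theorem networkAction_eq_mulVec {ι : Type} [Fintype ι] [DecidableEq ι] (L : Matrix ι ι ℂ)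
    (p : ℂ[X][X]) (v : ι → PowerSeries ℂ) :
    networkAction L p v = ((aeval (L.map (C : ℂ → ℂ[X])) p).map
      (Polynomial.coeToPowerSeries.ringHom (R := ℂ))).mulVec v := by
  rw [networkAction_apply, map_aeval_matrix (RingHom.id _)
    (Polynomial.coeToPowerSeries.ringHom (R := ℂ)) (by ext <;> simp [PowerSeries.algebraMap_apply'])
    (L.map (C : ℂ → ℂ[X])) p]
  congr 3
  · ext i j; simp
  · simp

/-- Multiplying by the adjugate shows that each entry of Y is a polynomial divided by the stable
polynomial det M. -/
theorem vanishing_of_mulVec_eq {ι : Type} [Fintype ι] [DecidableEq ι] {M : Matrix ι ι ℂ[X]}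
    (hM : IsStable M.det) {Y : ι → PowerSeries ℂ} {b : ι → ℂ[X]}
    (h : (M.map (Polynomial.coeToPowerSeries.ringHom (R := ℂ))).mulVec Y =
      fun i => (b i : PowerSeries ℂ)) (i : ι) : Vanishing (Y i) := by
  refine vanishing_of_isStable hM (P := (M.adjugate.mulVec b) i) ?_
  have h1 := congrArg ((M.adjugate.map (Polynomial.coeToPowerSeries.ringHom (R := ℂ))).mulVec) h
  rw [Matrix.mulVec_mulVec, ← Matrix.map_mul, Matrix.adjugate_mul] at h1
  have h2 := congrFun h1 i
  have h3 : ((M.det • (1 : Matrix ι ι ℂ[X])).map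
      (Polynomial.coeToPowerSeries.ringHom (R := ℂ))).mulVec Y i = (M.det : PowerSeries ℂ) * Y i := by
    simp [Matrix.mulVec, dotProduct, Matrix.one_apply, apply_ite]
  rw [h3] at h2
  rw [h2]
  have h4 := RingHom.map_mulVec (Polynomial.coeToPowerSeries.ringHom (R := ℂ)) M.adjugate b i
  exact h4.symm

/-- Disagreement between the agents vanishes for small `ε`. -/
theorem exists_vanishing_disagreement {ι : Type} [Fintype ι] [DecidableEq ι] {L : Matrix ι ι ℂ}
    {D N : ℂ[X][X]} (hD : ∀ μ ∈ spectrum ℂ L, IsStable (D.eval (C μ))) {p q : ℂ[X]}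
    {g : PowerSeries ℂ} (hq : IsStable q)
    (hg : (q : PowerSeries ℂ) * (((1 - X : ℂ[X]) : PowerSeries ℂ) * g) = p) :
    ∃ ε₀ > (0 : ℝ), ∀ ε : ℝ, |ε| < ε₀ → ∀ (Y U : ι → PowerSeries ℂ) (b : ι → ℂ[X]),
      networkAction L D Y = networkAction L (C ((X - C 1) ^ 2) * N) (g • U) →
      (∀ i, ((1 - X : ℂ[X]) : PowerSeries ℂ) * U i =
        ((C (ε : ℂ) * (1 - X) : ℂ[X]) : PowerSeries ℂ) * Y i + b i) →
      ∀ i, Vanishing (Y i) := by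
  obtain ⟨ε₀, hε₀, hst⟩ := exists_isStable_det_sub
    (aeval (L.map (C : ℂ → ℂ[X])) (C q * D)) (aeval (L.map (C : ℂ → ℂ[X])) (C (p * (1 - X)) * N))
    (isStable_det_aeval fun μ hμ => by
      rw [eval_mul, eval_C]
      exact hq.mul (hD μ hμ))
  refine ⟨ε₀, hε₀, fun ε hε Y U b hY hU => ?_⟩
  have hM : aeval (L.map (C : ℂ → ℂ[X])) (C q * D) -
      C (ε : ℂ) • aeval (L.map (C : ℂ → ℂ[X])) (C (p * (1 - X)) * N) =
      aeval (L.map (C : ℂ → ℂ[X])) (C q * D - C (C (ε : ℂ) * (p * (1 - X))) * N) := by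
    rw [map_sub, C_mul (a := C (ε : ℂ)), mul_assoc, map_mul _ (C (C (ε : ℂ))), aeval_C,
      Algebra.smul_def]
  have hst' := hst ε hε
  rw [hM] at hst'
  refine vanishing_of_mulVec_eq hst'
    (b := (aeval (L.map (C : ℂ → ℂ[X])) (C p * N)).mulVec b) ?_
  rw [← networkAction_eq_mulVec]
  have hb : (fun i => (((aeval (L.map (C : ℂ → ℂ[X])) (C p * N)).mulVec b i : ℂ[X]) :
      PowerSeries ℂ)) = networkAction L (C p * N) (fun i => (b i : PowerSeries ℂ)) := by
    rw [networkAction_eq_mulVec]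
    ext i : 1
    exact RingHom.map_mulVec (Polynomial.coeToPowerSeries.ringHom (R := ℂ)) _ b i
  rw [hb]
  obtain ⟨φ, hφ, hC⟩ : ∃ φ, networkAction L = φ ∧
      (∀ p v, φ (C p) v = (p : PowerSeries ℂ) • v) := ⟨_, rfl, networkAction_C L⟩
  rw [hφ] at hY ⊢
  -- The double zero at work: one factor 1 - X cancels the pole of g, the other the pole that U
  -- inherits from its constant part. The forcing is left polynomial, and Y enters with the factor
  -- ε.
  have hU' : (q : PowerSeries ℂ) • ((((X - C 1) ^ 2 : ℂ[X]) : PowerSeries ℂ) • (g • U)) =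
      ((C (ε : ℂ) * (p * (1 - X)) : ℂ[X]) : PowerSeries ℂ) • Y +
        (p : PowerSeries ℂ) • fun i => (b i : PowerSeries ℂ) := by
    ext i : 1
    have h2 : ((X - C 1) ^ 2 : ℂ[X]) = (1 - X) * (1 - X) := by rw [C_1]; ring
    have h3 := hU i
    simp only [Pi.smul_apply, Pi.add_apply, smul_eq_mul, h2, Polynomial.coe_mul] at h3 ⊢
    linear_combination ((1 - X : ℂ[X]) : PowerSeries ℂ) * U i * hg + (p : PowerSeries ℂ) * h3
  have hcomm : ∀ (f : PowerSeries ℂ) v, f • φ N v = φ N (f • v) := fun f v =>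
    ((φ N).map_smul f v).symm
  have hmul : ∀ (a : ℂ[X]) (v : _ → PowerSeries ℂ),
      φ (C a * N) v = φ N ((a : PowerSeries ℂ) • v) := fun a v => by
    rw [map_mul φ (C a) N, Module.End.mul_apply, hC, hcomm]
  rw [map_sub, LinearMap.sub_apply, hmul, hmul, map_mul φ (C q) D, Module.End.mul_apply, hC, hY,
    hmul, hcomm, hU', map_add, add_sub_cancel_left]

/-! ### Averaging, disagreement and the shifted Laplacian -/

theorem tendsto_of_vanishing {y : ℕ → ℝ} {c : ℝ}
    (h : Vanishing (signalSeries y - PowerSeries.C (c : ℂ) * stepSeries)) :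
    Tendsto y atTop (𝓝 c) := by
  rw [← tendsto_sub_nhds_zero_iff]
  have := (Complex.continuous_re.tendsto 0).comp h
  rw [Complex.zero_re] at this
  refine this.congr fun t => ?_
  simp [coeff_signalSeries, stepSeries]

/-- The matrix that averages over the agents. -/
def averaging (n : ℕ) : Matrix (Fin n) (Fin n) ℂ := Matrix.of fun _ _ => (n : ℂ)⁻¹

theorem laplacianC_mul_averaging {n : ℕ} (A : Matrix (Fin n) (Fin n) ℝ) :
    laplacianC A * averaging n = 0 := by
  ext i j
  have : ∑ k, laplacianC A i k = 0 := by
    simp only [laplacianC, Matrix.map_apply]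
    rw [← Complex.ofReal_sum, sum_laplacian_row, Complex.ofReal_zero]
  simp [Matrix.mul_apply, averaging, ← Finset.sum_mul, this]

theorem IsBalancedWeighting.sum_laplacianC {n : ℕ} {N : Digraph (Fin n)}
    {A : Matrix (Fin n) (Fin n) ℝ} (h : IsBalancedWeighting N A) (j : Fin n) :
    ∑ i, laplacianC A i j = 0 := by
  simp only [laplacianC, Matrix.map_apply]
  rw [← Complex.ofReal_sum, h.balanced, Complex.ofReal_zero]

theorem averaging_mul_self {n : ℕ} : averaging n * averaging n = averaging n := by
  ext i j
  have : (n : ℂ) ≠ 0 := Nat.cast_ne_zero.2 (by rintro rfl; exact i.elim0)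
  simp [Matrix.mul_apply, averaging]
  field_simp

/-- The averaging projection annihilates L on both sides and kills `1 - averaging n`. So the
disagreement also obeys the network equations with κ added on the constant vectors, which replaces
the eigenvalue 0, where D may fail to be stable. -/
theorem IsBalancedWeighting.intertwine {n : ℕ} {N : Digraph (Fin n)}
    {A : Matrix (Fin n) (Fin n) ℝ} (h : IsBalancedWeighting N A) (κ : ℂ) :
    (1 - averaging n) * laplacianC A =
      (laplacianC A + κ • averaging n) * (1 - averaging n) := by
  have h1 : averaging n * laplacianC A = 0 := by
    ext i j
    simp [Matrix.mul_apply, averaging, ← Finset.mul_sum, h.sum_laplacianC]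
  rw [sub_mul, mul_sub, add_mul _ _ (averaging n), h1, laplacianC_mul_averaging, Matrix.smul_mul,
    averaging_mul_self]
  simp

/-- The eigenvalues of the Laplacian with the zero eigenvalue shifted to `κ`. -/
theorem IsBalancedWeighting.mem_spectrum_shift {n : ℕ} {N : Digraph (Fin n)}
    {A : Matrix (Fin n) (Fin n) ℝ} (h : IsBalancedWeighting N A) (hN : IsConnected N) {κ μ : ℂ}
    (hμ : μ ∈ spectrum ℂ (laplacianC A + κ • averaging n)) :
    μ = κ ∨ (μ ∈ spectrum ℂ (laplacianC A) ∧ 0 < μ.re ∧ |μ.im| ≤ sectorConst n * μ.re) := by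
  obtain ⟨v, hv0, hv⟩ := mem_spectrum_iff_exists_mulVec.1 hμ
  have hn : (n : ℂ) ≠ 0 := by
    rintro h0
    have : n = 0 := by exact_mod_cast h0
    subst this
    exact hv0 (Subsingleton.elim _ _)
  have hJ : ∀ i, (averaging n).mulVec v i = (n : ℂ)⁻¹ * ∑ j, v j := fun i => by
    simp [averaging, Matrix.mulVec, dotProduct, Finset.mul_sum]
  -- The shift does not see an eigenvector with zero sum, and connectivity excludes Re μ = 0 for it.
  -- Otherwise summing the entries of the eigenvector equation removes L and leaves μ = κ.
  by_cases hs : ∑ i, v i = 0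
  · right
    have hv' : (laplacianC A).mulVec v = μ • v := by
      rw [← hv, Matrix.add_mulVec, Matrix.smul_mulVec]
      have : (averaging n).mulVec v = 0 := by ext i; simp [hJ, hs]
      rw [this, smul_zero, add_zero]
    have him := h.abs_im_le hv0 hv'
    refine ⟨mem_spectrum_iff_exists_mulVec.2 ⟨v, hv0, hv'⟩, ?_, him⟩
    have hre : 0 ≤ μ.re := by
      have := (abs_nonneg _).trans him
      exact nonneg_of_mul_nonneg_right this (sectorConst_pos n)
    refine hre.lt_of_ne fun h0 => hv0 ?_
    have hconst := h.eq_of_re_eq_zero hN hv' h0.symm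
    ext i
    have h1 : ∑ j, v j = n * v i := by
      rw [Finset.sum_congr rfl fun j _ => hconst j i]
      simp
    rw [hs, eq_comm, mul_eq_zero] at h1
    exact h1.resolve_left hn
  · left
    have h1 : ∑ i, (laplacianC A + κ • averaging n).mulVec v i = μ * ∑ i, v i := by
      rw [hv, Finset.mul_sum]; rfl
    have h2 : ∑ i, (laplacianC A).mulVec v i = 0 := by
      simp only [Matrix.mulVec, dotProduct]
      rw [Finset.sum_comm]
      simp [← Finset.sum_mul, h.sum_laplacianC]
    rw [Matrix.add_mulVec, Matrix.smul_mulVec] at h1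
    simp only [Pi.add_apply, Pi.smul_apply, Finset.sum_add_distrib, h2, hJ, zero_add,
      Finset.sum_const, Finset.card_univ, Fintype.card_fin, smul_eq_mul, nsmul_eq_mul] at h1
    refine (mul_right_cancel₀ hs ?_).symm
    rw [← h1]
    field_simp

/-- The series network of the estimator inside the combined system. -/
theorem IsNetworkTrajectory.isSeriesNetwork_combine {m n : ℕ} {Gcon : AgentSystem m}
    {Gopt : RatFunc ℝ} (hopt : IsProper Gopt) (hcon : ∀ i j, IsProper (Gcon i j))
    {A : Matrix (Fin n) (Fin n) ℝ} {u : Fin n → ℕ → ℝ} {v : Fin n → Fin m → ℕ → ℝ}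
    {y : Fin n → ℕ → ℝ} {z : Fin n → Fin m → ℕ → ℝ}
    (h : IsNetworkTrajectory (combine Gcon Gopt) A u v y z) :
    IsSeriesNetwork (Gcon.map impulseC) (laplacianC A)
      (impulseC Gopt • fun i => signalSeries (u i))
      (fun k i => signalSeries (v i k)) (fun i => signalSeries (y i))
      (fun k i => signalSeries (z i k)) := by
  have h' := h.isSeriesNetwork
  have hl : ∀ s, (combine Gcon Gopt).map impulseC s (Sum.inl ()) =
      Gcon.map impulseC s (Sum.inl ()) * impulseC Gopt := fun s => by
    rw [Matrix.map_apply, combine_inl, impulseC_mul (hcon _ _) hopt, Matrix.map_apply]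
  have hr : ∀ s k, (combine Gcon Gopt).map impulseC s (Sum.inr k) =
      Gcon.map impulseC s (Sum.inr k) := fun s k => by
    rw [Matrix.map_apply, combine_inr, Matrix.map_apply]
  refine ⟨?_, fun k => ?_, h'.network⟩
  · rw [smul_smul, ← hl]
    simpa only [hr] using h'.output
  · rw [smul_smul, ← hl]
    simpa only [hr] using h'.message k

/-- The closed loop of the combined system: `uᵢ = ε (yᵢ - sᵢ) + dᵢ`. -/
theorem exists_convergence {m n : ℕ} {Gcon : AgentSystem m} {Gopt : RatFunc ℝ}
    (hopt_causal : IsProper Gopt) (hcon_causal : ∀ i j, IsProper (Gcon i j))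
    {N : Digraph (Fin n)} {A : Matrix (Fin n) (Fin n) ℝ} (hA : IsBalancedWeighting N A)
    {L : Matrix (Fin n) (Fin n) ℂ}
    (hL : (1 - averaging n) * laplacianC A = L * (1 - averaging n)) {D N' : ℂ[X][X]}
    (hD : ∀ μ ∈ spectrum ℂ L, IsStable (D.eval (C μ)))
    (hDN : ∀ (ι : Type) [Fintype ι] [DecidableEq ι] (L : Matrix ι ι ℂ) (W : ι → PowerSeries ℂ)
        (V : Fin m → ι → PowerSeries ℂ) (Y : ι → PowerSeries ℂ) (Z : Fin m → ι → PowerSeries ℂ),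
        IsSeriesNetwork (Gcon.map impulseC) L W V Y Z →
          networkAction L D Y = networkAction L (C ((X - C 1) ^ 2) * N') W)
    {a b p q : ℂ[X]} (hb : IsStable b) (hab : a.eval 1 = b.eval 1)
    (ha : (b : PowerSeries ℂ) * impulseC (Gcon (Sum.inl ()) (Sum.inl ())) = a)
    (hq : IsStable q) (hpq : (p.eval 1 / q.eval 1).re < 0)
    (hp : (q : PowerSeries ℂ) * (((1 - X : ℂ[X]) : PowerSeries ℂ) * impulseC Gopt) = p) :
    ∃ ε₀ > (0 : ℝ), ∀ ε : ℝ, 0 ≤ ε → ε < ε₀ → ∀ (s : Fin n → ℝ) (d : Fin n → ℕ →₀ ℝ)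
      (u : Fin n → ℕ → ℝ) (v : Fin n → Fin m → ℕ → ℝ) (y : Fin n → ℕ → ℝ)
      (z : Fin n → Fin m → ℕ → ℝ), IsNetworkTrajectory (combine Gcon Gopt) A u v y z →
      (∀ i t, u i t = ε * (y i t - s i) + d i t) →
      (0 < ε → ∀ i, Tendsto (y i) atTop (𝓝 ((∑ j, s j) / n))) ∧
      (ε = 0 → ∃ c, ∀ i, Tendsto (y i) atTop (𝓝 c)) := by
  obtain ⟨ε₁, hε₁, hdis⟩ := exists_vanishing_disagreement (N := N') hD hq hp
  obtain ⟨ε₂, hε₂, hmean⟩ := exists_isStable_sub hb hq hab hpq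
  refine ⟨min ε₁ ε₂, lt_min hε₁ hε₂, fun ε hε0 hε s d u v y z htraj hu => ?_⟩
  have hnet := htraj.isSeriesNetwork_combine hopt_causal hcon_causal
  set g := impulseC Gopt with hg
  set Y : Fin n → PowerSeries ℂ := fun i => signalSeries (y i) with hY
  set U : Fin n → PowerSeries ℂ := fun i => signalSeries (u i) with hU
  choose P hP using fun i => signalSeries_finsupp (d i)
  have hstep := one_sub_X_mul_stepSeries
  have hUY : ∀ i, U i = PowerSeries.C (ε : ℂ) * (Y i - PowerSeries.C (s i : ℂ) * stepSeries) +
      P i := by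
    intro i
    ext t
    rw [hP, map_add, PowerSeries.coeff_C_mul, map_sub, PowerSeries.coeff_C_mul]
    simp [hU, hY, coeff_signalSeries, hu, stepSeries]
  have hUX : ∀ i, ((1 - X : ℂ[X]) : PowerSeries ℂ) * U i =
      ((C (ε : ℂ) * (1 - X) : ℂ[X]) : PowerSeries ℂ) * Y i +
        ((C (-(ε * s i : ℂ)) + (1 - X) * P i : ℂ[X]) : PowerSeries ℂ) := by
    intro i
    rw [hUY i, Polynomial.coe_mul, Polynomial.coe_add, Polynomial.coe_mul, Polynomial.coe_C,
      Polynomial.coe_C, map_neg, map_mul]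
    linear_combination (-PowerSeries.C (ε : ℂ) * PowerSeries.C (s i : ℂ)) * hstep
  -- The disagreement between the agents vanishes.
  have hdis' : ∀ i, Vanishing ((((1 - averaging n).map (PowerSeries.C (R := ℂ))).mulVec Y) i) := by
    have hcomb := hnet.combine (1 - averaging n) hL
    rw [Matrix.mulVec_smul] at hcomb
    refine hdis ε (by rw [abs_of_nonneg hε0]; exact hε.trans_le (min_le_left _ _)) _ _
      (fun i => ∑ j, C ((1 - averaging n) i j) * (C (-(ε * s j : ℂ)) + (1 - X) * P j))
      (hDN _ _ _ _ _ _ hcomb) fun i => ?_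
    simp only [Matrix.mulVec, dotProduct, Matrix.map_apply, Finset.mul_sum]
    have hsum : ((∑ j, C ((1 - averaging n) i j) * (C (-(ε * s j : ℂ)) + (1 - X) * P j) : ℂ[X]) :
        PowerSeries ℂ) = ∑ j, PowerSeries.C ((1 - averaging n) i j) *
          ((C (-(ε * s j : ℂ)) + (1 - X) * P j : ℂ[X]) : PowerSeries ℂ) := by
      rw [← Polynomial.coeToPowerSeries.ringHom_apply, map_sum]
      refine Finset.sum_congr rfl fun j _ => ?_
      rw [Polynomial.coeToPowerSeries.ringHom_apply, Polynomial.coe_mul, Polynomial.coe_C]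
    rw [hsum, ← Finset.sum_add_distrib]
    refine Finset.sum_congr rfl fun j _ => ?_
    rw [mul_left_comm, hUX j, mul_add, mul_left_comm]
  -- The average obeys the loop of the optimization method.
  have hc : (Matrix.of fun (_ : Unit) (_ : Fin n) => (n : ℂ)⁻¹) * laplacianC A =
      (0 : Matrix Unit Unit ℂ) * Matrix.of fun (_ : Unit) (_ : Fin n) => (n : ℂ)⁻¹ := by
    ext i j
    simp [Matrix.mul_apply, ← Finset.mul_sum, hA.sum_laplacianC]
  have hav := hnet.combine (κ := Unit) (Matrix.of fun _ _ => (n : ℂ)⁻¹) (L' := 0) hc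
  set avg : (Fin n → PowerSeries ℂ) → PowerSeries ℂ :=
    fun f => ∑ j, PowerSeries.C (n : ℂ)⁻¹ * f j with havg
  have havgY : avg Y = impulseC (Gcon (Sum.inl ()) (Sum.inl ())) * (g * avg U) := by
    have h1 := congrFun hav.output ()
    have h2 : ∀ k, ((Matrix.of fun (_ : Unit) (_ : Fin n) => (n : ℂ)⁻¹).map
        (PowerSeries.C (R := ℂ))).mulVec (fun i => signalSeries (v i k)) = 0 := fun k => by
      rw [hav.network k]; ext i : 1; simp
    simp only [h2, smul_zero, Finset.sum_const_zero, add_zero, Matrix.mulVec_smul] at h1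
    exact h1
  set sbar : ℝ := (∑ j, s j) / n with hsbar
  have hsum : ∑ j, PowerSeries.C (n : ℂ)⁻¹ * PowerSeries.C (s j : ℂ) =
      PowerSeries.C (sbar : ℂ) := by
    rw [← Finset.mul_sum, ← map_sum, ← map_mul, hsbar]
    congr 1
    push_cast
    rw [div_eq_inv_mul]
  have havgU : avg U = PowerSeries.C (ε : ℂ) * (avg Y - PowerSeries.C (sbar : ℂ) * stepSeries) +
      ((C (n : ℂ)⁻¹ * ∑ j, P j : ℂ[X]) : PowerSeries ℂ) := by
    have h1 : ((∑ j, P j : ℂ[X]) : PowerSeries ℂ) = ∑ j, (P j : PowerSeries ℂ) := by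
      simp only [← Polynomial.coeToPowerSeries.ringHom_apply, map_sum]
    rw [← hsum, Polynomial.coe_mul, Polynomial.coe_C, h1, Finset.sum_mul,
      ← Finset.sum_sub_distrib, Finset.mul_sum, Finset.mul_sum, ← Finset.sum_add_distrib]
    refine Finset.sum_congr rfl fun j _ => ?_
    rw [hUY j]
    ring
  set dbar : ℂ[X] := C (n : ℂ)⁻¹ * ∑ j, P j with hdbar
  have hsplit : ∀ i, (((1 - averaging n).map (PowerSeries.C (R := ℂ))).mulVec Y) i =
      Y i - avg Y := by
    intro i
    simp only [Matrix.mulVec, dotProduct, Matrix.map_apply, Matrix.sub_apply, map_sub, sub_mul,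
      Finset.sum_sub_distrib]
    congr 1
    simp [Matrix.one_apply, apply_ite]
  have hloop : ((1 - X : ℂ[X]) : PowerSeries ℂ) * ((b * q : ℂ[X]) : PowerSeries ℂ) * avg Y =
      ((a * p : ℂ[X]) : PowerSeries ℂ) * avg U := by
    rw [Polynomial.coe_mul, Polynomial.coe_mul, ← ha, ← hp, havgY]
    ring
  -- Each yᵢ is the average plus its disagreement, which vanishes; only the average remains to be
  -- studied.
  have hfinal : ∀ c : ℝ, Vanishing (avg Y - PowerSeries.C (c : ℂ) * stepSeries) → ∀ i,
      Tendsto (y i) atTop (𝓝 c) := by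
    intro c h i
    refine tendsto_of_vanishing ?_
    have h1 := (hdis' i).add h
    rw [hsplit] at h1
    have h2 : Y i - avg Y + (avg Y - PowerSeries.C (c : ℂ) * stepSeries) =
        signalSeries (y i) - PowerSeries.C (c : ℂ) * stepSeries := by
      rw [hY]; ring
    rwa [h2] at h1
  constructor
  · intro hεpos
    refine hfinal sbar (vanishing_of_isStable (hmean ε hεpos (hε.trans_le (min_le_right _ _)))
      (P := a * p * dbar - b * q * C (sbar : ℂ)) ?_)
    simp only [Polynomial.coe_sub, Polynomial.coe_mul, Polynomial.coe_C] at hloop hstep havgU ⊢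
    linear_combination hloop + (a : PowerSeries ℂ) * p * havgU -
      PowerSeries.C (sbar : ℂ) * b * q * hstep
  · rintro rfl
    rw [Complex.ofReal_zero, map_zero, zero_mul, zero_add] at havgU
    -- Without gradients the average has one integrator driven by a finitely supported signal
    -- through stable dynamics, so it converges, though not necessarily to zero.
    have h1 : IsSummable (((1 - X : ℂ[X]) : PowerSeries ℂ) * avg Y) := by
      refine isSummable_of_isStable (hb.mul hq) (P := a * p * dbar) ?_
      rw [Polynomial.coe_mul (a * p), ← havgU, ← hloop]
      ring
    obtain ⟨c, hc⟩ := exists_tendsto_of_isSummable h1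
    refine ⟨c.re, fun i => ?_⟩
    have h2 := hc.add (hdis' i)
    have h3 := (Complex.continuous_re.tendsto _).comp h2
    rw [add_zero] at h3
    refine h3.congr fun t => ?_
    rw [Function.comp_apply, ← map_add, hsplit, add_sub_cancel, hY, coeff_signalSeries,
      Complex.ofReal_re]

end

end DistOpt

end

/-! ### Assembly -/

theorem theorem2 (m : ℕ) (Gopt : RatFunc ℝ) (Gcon : DistOpt.AgentSystem m)
    (hopt_causal : DistOpt.IsProper Gopt)
    (hopt : DistOpt.IsOptimizationMethod Gopt)
    (hcon_causal : ∀ i j, DistOpt.IsProper (Gcon i j))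
    (hcon_strict : ∀ i j, DistOpt.IsStrictlyProper (Gcon.toBlocks₂₂ i j))
    (hcon : DistOpt.IsConsensusEstimator 2 Gcon)
    (hopt_minPhase : ∀ z : ℂ, DistOpt.IsZeroOf z (DistOpt.toComplex Gopt) → ‖z‖ < 1)
    (hcon_minPhase : DistOpt.ForSmallLaplacians fun _ A =>
      ∀ lam ∈ spectrum ℂ (DistOpt.laplacianC A), ∀ z : ℂ,
        DistOpt.IsZeroOf z (DistOpt.closeWith Gcon lam) → z ≠ 1 → ‖z‖ < 1)
    (hstrict : DistOpt.IsStrictlyProper Gopt ∨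
      ∀ i j, DistOpt.IsStrictlyProper ((Gcon.toBlocks₂₁ * Gcon.toBlocks₁₂) i j)) :
    (∀ i j, DistOpt.IsProper (DistOpt.combine Gcon Gopt i j)) ∧
    (∀ i j, DistOpt.IsStrictlyProper ((DistOpt.combine Gcon Gopt).toBlocks₂₂ i j)) ∧
    (∀ i j, DistOpt.IsStrictlyProper
      (((DistOpt.combine Gcon Gopt).toBlocks₂₁ * (DistOpt.combine Gcon Gopt).toBlocks₁₂) i j)) ∧
    DistOpt.IsDistributedOptimizationAlgorithm (DistOpt.combine Gcon Gopt) := by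
  have hH22 : ∀ i j,
      DistOpt.IsStrictlyProper ((DistOpt.combine Gcon Gopt).toBlocks₂₂ i j) := fun i j => by
    have := hcon_strict i j
    rw [Matrix.toBlocks₂₂, Matrix.of_apply] at this ⊢
    rwa [DistOpt.combine_inr]
  refine ⟨DistOpt.isProper_combine hopt_causal hcon_causal, hH22,
    DistOpt.isStrictlyProper_combine_mul hopt_causal hcon_causal hstrict, ?_⟩
  obtain ⟨D, N', hD, hDN⟩ := DistOpt.exists_transfer_of_consensus hcon_strict hcon
  obtain ⟨a, b, hb, hab, ha⟩ := DistOpt.exists_output_eq_of_consensus two_pos hcon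
  obtain ⟨p, q, hq, hpq, hp⟩ := DistOpt.exists_response_eq_of_optimizationMethod hopt
  have hpq' : ((p.map Complex.ofRealHom).eval 1 / (q.map Complex.ofRealHom).eval 1).re < 0 := by
    have h1 : ∀ f : Polynomial ℝ, (f.map Complex.ofRealHom).eval 1 = ((f.eval 1 : ℝ) : ℂ) :=
      fun f => by
        have := Polynomial.eval_map_apply (p := f) Complex.ofRealHom 1
        rwa [map_one] at this
    rw [h1, h1, ← Complex.ofReal_div, Complex.ofReal_re]
    rcases mul_neg_iff.1 hpq with ⟨h2, h3⟩ | ⟨h2, h3⟩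
    · exact div_neg_of_pos_of_neg h2 h3
    · exact div_neg_of_neg_of_pos h2 h3
  intro n N hN
  -- The sector depends on n alone, so δ is available before the weights are chosen.
  obtain ⟨δ, hδ, hstable⟩ := hD _ (DistOpt.sectorConst_pos n)
  refine ⟨δ, hδ, fun A hA hrad => ?_⟩
  -- κ = δ / 2 is real, positive and below δ, hence itself in the region where D is stable.
  have hκ : ∀ μ ∈ spectrum ℂ (DistOpt.laplacianC A + ((δ / 2 : ℝ) : ℂ) • DistOpt.averaging n),
      DistOpt.IsStable (D.eval (Polynomial.C μ)) := by
    intro μ hμ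
    rcases hA.mem_spectrum_shift hN hμ with rfl | ⟨hμ', hre, him⟩
    · refine hstable _ ?_ ?_ ?_
      · rw [Complex.ofReal_re]; positivity
      · rw [Complex.ofReal_re, Complex.ofReal_im, abs_zero]
        have := DistOpt.sectorConst_pos n
        positivity
      · rw [Complex.norm_of_nonneg (by positivity)]
        linarith
    · exact hstable μ hre him (DistOpt.norm_lt_of_spectralRadius_lt hrad hμ')
  obtain ⟨ε₁, hε₁, hconv⟩ := DistOpt.exists_convergence hopt_causal hcon_causal hA
    (hA.intertwine _) hκ hDN hb hab ha hq hpq' hp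
  obtain ⟨ε₂, hε₂, hex⟩ := DistOpt.exists_networkTrajectory_feedback hH22 A
  refine ⟨⟨min ε₁ ε₂, lt_min hε₁ hε₂, fun ε hε0 hε ystar d => ⟨?_, ?_⟩⟩, fun d => ⟨?_, ?_⟩⟩
  · obtain ⟨u, v, y, z, htraj, hu⟩ := hex ε
      (by rw [abs_of_pos hε0]; exact hε.trans_le (min_le_right _ _))
      fun i t => -(ε * ystar i) + d i t
    refine ⟨u, v, y, z, htraj, fun i t => ?_⟩
    rw [hu, DistOpt.deriv_quadratic]; ring
  · intro u v y z htraj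
    refine (hconv ε hε0.le (hε.trans_le (min_le_left _ _)) ystar d u v y z htraj.network
      fun i t => ?_).1 hε0
    rw [htraj.feedback, DistOpt.deriv_quadratic]
  · obtain ⟨u, v, y, z, htraj, hu⟩ := hex 0 (by simpa using hε₂) fun i t => d i t
    refine ⟨u, v, y, z, htraj, fun i t => ?_⟩
    rw [hu, deriv_const]; ring
  · intro u v y z htraj
    refine (hconv 0 le_rfl hε₁ 0 d u v y z htraj.network fun i t => ?_).2 rfl
    rw [htraj.feedback, deriv_const]; ring
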